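/- **Theorem 5.6 (Approximate eigenfunction for the employee-firing chain with VPs).** Let $q_1,q_2,q_3\ge 0$ with $q_1+q_2+q_3=1$ and $q_1+q_3>0$, and let $n_0\ge 2$. *The chain.* Let $\mathcal H$ be the Connes–Kreimer Hopf algebra over $\mathbb R$: its basis is the set of isomorphism classes of finite rooted forests, graded by the number of vertices; its product is disjoint union; its coproduct is $\Delta(x)=\sum_S (x\setminus S)\otimes S$, where $S$ runs over the vertex subsets of $x$ that contain all ancestors of each of their elements. For nonnegative integers $d_1,\dots,d_l$ let $\Delta_{d_1,\dots,d_l}$ be the iterated coproduct followed by projection to the tensors of degrees $d_1,\dots,d_l$, let $m$ be the multiplication, and let $\eta(x)$ be the coefficient of $\bullet\otimes\dots\otimes\bullet$ in $\Delta_{1,\dots,1}(x)$, where $\bullet$ is the one-vertex forest. Put $$T:=\sum_{r_1+r_2+r_3=n_0}\frac{1}{r_1!\,r_3!}\,q_1^{r_1}q_2^{r_2}q_3^{r_3}\; m\Delta_{1^{r_1},\,r_2,\,1^{r_3}} .$$ Let $\{X_t\}_{t\ge 0}$ be the trinomial-top-or-bottom-to-random chain on the rooted forests with $n_0$ vertices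 (the employee-firing chain with VPs), i.e. the Markov chain with transition matrix $$K(x,y)=\frac{\eta(y)}{\eta(x)}\cdot\bigl(\text{coefficient of } y \text{ in } T(x)\bigr),$$ started from an arbitrary rooted forest $X_0$ with $n_0$ vertices (for instance, a tree: a company with $n_0$ employees and no VPs). Thus $\mathbb E\{f(X_t)\}=\sum_y K^t(X_0,y)f(y)$. *The functions.* For a vertex $u$ of a forest $x$, let $h(u)$ be the number of vertices in the hook of $u$ ($u$ and all its descendants), and let $a(u)$ be the number of ancestors of $u$, including $u$ itself. For each integer $j$ with $0\le j\le n_0-2$ define $$\tilde f_j(x):=\sum_{u\in x}\binom{h(u)}{n_0-j}\left(\frac{q_3}{q_1+q_3}\right)^{a(u)-1}\left(\frac{q_1}{q_1+q_3}\right)^{h(u)},$$ where the binomial coefficient is $0$ if $h(u)<n_0-j$, and $0^0=1$. *Claim.* For all integers $t\ge 0$ and $0\le j\le n_0-2$, $$\mathbb E\{\tilde f_j(X_t)\}\;\le\; q_2^{(n_0-j)t}\,\tilde f_j(X_0)\,\max_{u\in X_0:\,h(u)\ge n_0-j}\binom{n_0}{a(u)-1},$$ where the maximum is read as $0$ if there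 is no such $u$ (then $\tilde f_j(X_0)=0$; this does not occur when $X_0$ is a tree). -/

import Mathlib

open scoped TensorProduct

noncomputable section

/-- A concrete finite rooted forest.  `u ≤ v` means that `u` is an ancestor of `v` (or `v` itself),
so the roots are the minimal vertices and the leaves are the maximal ones.  A partial order on a
finite set is the ancestor relation of a rooted forest exactly when the ancestors of every vertex
form a chain. -/
structure FinForest : Type 1 where
  V : Type
  [fintypeV : Fintype V]
  [orderV : PartialOrder V]
  ancestors_chain : ∀ u v w : V, u ≤ w → v ≤ w → u ≤ v ∨ v ≤ u

attribute [instance] FinForest.fintypeV FinForest.orderV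

namespace FinForest

/-- The number of vertices. -/
def degree (P : FinForest) : ℕ := Fintype.card P.V

open Classical in
/-- `h(u)`: the number of vertices of the hook of `u` (that is, `u` and all its descendants). -/
def hook (P : FinForest) (u : P.V) : ℕ := (Finset.univ.filter fun v => u ≤ v).card

open Classical in
/-- `a(u)`: the number of ancestors of `u`, including `u` itself. -/
def anc (P : FinForest) (u : P.V) : ℕ := (Finset.univ.filter fun v => v ≤ u).card

open Classical in
/-- The forest induced on a set of vertices. -/
def restrict (P : FinForest) (S : Finset P.V) : FinForest where
  V := {v : P.V // v ∈ S}
  ancestors_chain u v w h₁ h₂ := P.ancestors_chain u.1 v.1 w.1 h₁ h₂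

/-- The disjoint union of two forests. -/
def union (P Q : FinForest) : FinForest where
  V := P.V ⊕ Q.V
  ancestors_chain := by
    rintro (u | u) (v | v) (w | w) h₁ h₂ <;> simp_all
    · exact P.ancestors_chain u v w h₁ h₂
    · exact Q.ancestors_chain u v w h₁ h₂

/-- The forest without vertices. -/
def empty : FinForest where
  V := Empty
  ancestors_chain u := u.elim

open Classical in
/-- The trunks of a forest: the sets of vertices closed under taking ancestors. -/
def trunks (P : FinForest) : Finset (Finset P.V) :=
  Finset.univ.filter fun S => IsLowerSet (S : Set P.V)

/-- Isomorphism of rooted forests. -/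
instance setoid : Setoid FinForest where
  r P Q := Nonempty (P.V ≃o Q.V)
  iseqv :=
    { refl := fun _ => ⟨OrderIso.refl _⟩
      symm := fun ⟨e⟩ => ⟨e.symm⟩
      trans := fun ⟨e⟩ ⟨f⟩ => ⟨e.trans f⟩ }

theorem degree_congr {P Q : FinForest} (e : P.V ≃o Q.V) : P.degree = Q.degree :=
  Fintype.card_congr e.toEquiv

theorem hook_congr {P Q : FinForest} (e : P.V ≃o Q.V) (u : P.V) : Q.hook (e u) = P.hook u := by
  classical
  symm
  refine Finset.card_bij (fun v _ => e v) ?_ ?_ ?_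
  · intro v hv; simpa using hv
  · intro v _ w _ h; exact e.injective h
  · intro w hw
    obtain ⟨v, rfl⟩ := e.surjective w
    exact ⟨v, by simpa using hw, rfl⟩

theorem anc_congr {P Q : FinForest} (e : P.V ≃o Q.V) (u : P.V) : Q.anc (e u) = P.anc u := by
  classical
  symm
  refine Finset.card_bij (fun v _ => e v) ?_ ?_ ?_
  · intro v hv; simpa using hv
  · intro v _ w _ h; exact e.injective h
  · intro w hw
    obtain ⟨v, rfl⟩ := e.surjective w
    exact ⟨v, by simpa using hw, rfl⟩

end FinForest

/-- (Undecorated) rooted forests, up to isomorphism. -/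
def RootedForest : Type 1 := Quotient FinForest.setoid

namespace RootedForest

def mk (P : FinForest) : RootedForest := Quotient.mk _ P

theorem mk_eq_of_iso {P Q : FinForest} (e : P.V ≃o Q.V) : mk P = mk Q := Quotient.sound ⟨e⟩

/-- The number of vertices. -/
def degree : RootedForest → ℕ :=
  Quotient.lift FinForest.degree fun _ _ ⟨e⟩ => FinForest.degree_congr e

/-- Rooted forests form a commutative monoid under disjoint union. -/
instance : CommMonoid RootedForest where
  mul := Quotient.map₂ FinForest.union
    fun _ _ ⟨e⟩ _ _ ⟨f⟩ => ⟨OrderIso.sumCongr e f⟩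
  one := mk FinForest.empty
  mul_assoc := by
    rintro ⟨P⟩ ⟨Q⟩ ⟨R⟩
    exact Quotient.sound ⟨OrderIso.sumAssoc P.V Q.V R.V⟩
  mul_comm := by
    rintro ⟨P⟩ ⟨Q⟩
    exact Quotient.sound ⟨OrderIso.sumComm P.V Q.V⟩
  one_mul := by
    rintro ⟨P⟩
    exact Quotient.sound ⟨
      { toEquiv := Equiv.emptySum Empty P.V
        map_rel_iff' := by
          rintro (u | u) (v | v)
          all_goals first | exact u.elim | exact v.elim | exact Sum.inr_le_inr_iff.symm }⟩
  mul_one := by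
    rintro ⟨P⟩
    exact Quotient.sound ⟨
      { toEquiv := Equiv.sumEmpty P.V Empty
        map_rel_iff' := by
          rintro (u | u) (v | v)
          all_goals first | exact u.elim | exact v.elim | exact Sum.inl_le_inl_iff.symm }⟩

end RootedForest

/-- The underlying algebra of the (undecorated) Connes-Kreimer Hopf algebra over `ℝ`: its basis is
the set of rooted forests, and the product of two forests is their disjoint union. -/
abbrev ConnesKreimer : Type 1 := MonoidAlgebra ℝ RootedForest

namespace ConnesKreimer

/-- The linear map with prescribed values on the basis of forests. -/
def liftBasis {A : Type*} [AddCommMonoid A] [Module ℝ A] (f : RootedForest → A) :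
    ConnesKreimer →ₗ[ℝ] A where
  toFun z := z.coeff.sum fun x c => c • f x
  map_add' z w := by
    simpa using Finsupp.sum_add_index' (f := z.coeff) (g := w.coeff) (h := fun x c => c • f x)
      (by simp) (by intros; simp [add_smul])
  map_smul' c z := by
    simp [Finsupp.sum_smul_index, Finsupp.smul_sum, mul_smul]

open Classical in
/-- `∑ (x \ S) ⊗ S` over all trunks `S` of the concrete forest `P`. -/
def forestComul (P : FinForest) : ConnesKreimer ⊗[ℝ] ConnesKreimer :=
  ∑ S ∈ P.trunks,
    MonoidAlgebra.single (RootedForest.mk (P.restrict Sᶜ)) (1 : ℝ) ⊗ₜ[ℝ]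
      MonoidAlgebra.single (RootedForest.mk (P.restrict S)) (1 : ℝ)

open Classical in
theorem forestComul_congr {P Q : FinForest} (e : P.V ≃o Q.V) : forestComul P = forestComul Q := by
  have key : ∀ (S : Finset P.V) (T : Finset Q.V), (∀ v, v ∈ S ↔ e v ∈ T) →
      RootedForest.mk (P.restrict S) = RootedForest.mk (Q.restrict T) := fun S T h =>
    RootedForest.mk_eq_of_iso (P := P.restrict S) (Q := Q.restrict T)
      { toEquiv := e.toEquiv.subtypeEquiv h
        map_rel_iff' := by
          rintro ⟨u, hu⟩ ⟨v, hv⟩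
          exact e.le_iff_le }
  unfold forestComul
  refine Finset.sum_equiv e.toEquiv.finsetCongr ?_ ?_
  · intro S
    simp only [FinForest.trunks, Finset.mem_filter, Finset.mem_univ, true_and]
    constructor
    · intro h a b hba ha
      simp only [Equiv.finsetCongr_apply, Finset.coe_map, Set.mem_image, Finset.mem_coe] at ha ⊢
      obtain ⟨v, hv, rfl⟩ := ha
      exact ⟨e.symm b, h (by simpa using e.symm.monotone hba) hv, by simp⟩
    · intro h a b hba ha
      have h' := h (a := e a) (b := e b) (e.monotone hba) (by simpa using ha)
      simpa using h'
  · intro S _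
    rw [key Sᶜ (e.toEquiv.finsetCongr S)ᶜ (by intro v; simp),
      key S (e.toEquiv.finsetCongr S) (by intro v; simp)]

/-- The coproduct `Δ(x) = ∑_S (x \ S) ⊗ S`, over all trunks `S` of `x`.  (In particular
`Δ_{1,n-1}` removes a leaf and `Δ_{n-1,1}` removes a root.) -/
def comul : ConnesKreimer →ₗ[ℝ] ConnesKreimer ⊗[ℝ] ConnesKreimer :=
  liftBasis (Quotient.lift forestComul fun _ _ ⟨e⟩ => forestComul_congr e)

/-- The counit: `1` on the empty forest, `0` on all other forests. -/
def counit : ConnesKreimer →ₗ[ℝ] ℝ := liftBasis fun x => if x.degree = 0 then 1 else 0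

/-- The projection onto the graded component of degree `d`. -/
def proj (d : ℕ) : ConnesKreimer →ₗ[ℝ] ConnesKreimer :=
  liftBasis fun x => if x.degree = d then MonoidAlgebra.single x 1 else 0

/-- The sum of the coefficients in the basis of forests. -/
def coeffSum : ConnesKreimer →ₗ[ℝ] ℝ := liftBasis fun _ => 1

/-- `m_A ∘ (F₁ ⊗ ⋯ ⊗ F_l) ∘ Δ^[l]` for a list of linear maps `F₁, …, F_l` into an algebra `A` with
product `m_A`, where `Δ^[l] = (Δ^[l-1] ⊗ id) ∘ Δ` is the iterated coproduct
(`Δ^[0]` is the counit). -/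
def mulComp {A : Type*} [Ring A] [Algebra ℝ A] (F : List (ConnesKreimer →ₗ[ℝ] A)) :
    ConnesKreimer →ₗ[ℝ] A :=
  F.foldl (fun G f => LinearMap.mul' ℝ A ∘ₗ TensorProduct.map G f ∘ₗ comul)
    (Algebra.linearMap ℝ A ∘ₗ counit)

/-- The descent operator `m Δ_D`, where `Δ_D` is the iterated coproduct followed by the projection
onto the tensors of degrees `d₁, …, d_l`. -/
def descentOp (D : List ℕ) : ConnesKreimer →ₗ[ℝ] ConnesKreimer := mulComp (D.map proj)

/-- The rescaling function on forests with `n` vertices: the sum of the coefficients of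
`Δ_{1,…,1}(x)` in the basis of `n`-fold tensors of forests on one vertex. -/
def eta (n : ℕ) : ConnesKreimer →ₗ[ℝ] ℝ := mulComp (List.replicate n (coeffSum ∘ₗ proj 1))

/-- The trinomial-top-or-bottom-to-random operator
`∑_{r₁+r₂+r₃=n} (1 / (r₁! r₃!)) q₁^r₁ q₂^r₂ q₃^r₃ m Δ_{1^r₁, r₂, 1^r₃}`. -/
def trintober (n : ℕ) (q₁ q₂ q₃ : ℝ) : ConnesKreimer →ₗ[ℝ] ConnesKreimer :=
  ∑ r ∈ Finset.HasAntidiagonal.antidiagonal n, ∑ s ∈ Finset.HasAntidiagonal.antidiagonal r.2,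
    (q₁ ^ r.1 * q₂ ^ s.1 * q₃ ^ s.2 / (r.1.factorial * s.2.factorial : ℝ)) •
      descentOp (List.replicate r.1 1 ++ [s.1] ++ List.replicate s.2 1)

end ConnesKreimer

namespace RootedForest

/-- The rooted forests with `n` vertices: the state space of the chain. -/
def OfDegree (n : ℕ) : Type 1 := {x : RootedForest // x.degree = n}

instance finite_ofDegree (n : ℕ) : Finite (OfDegree n) := by
  classical
  have : Finite (PartialOrder (Fin n)) :=
    Finite.of_injective (fun o : PartialOrder (Fin n) => o.le) fun a b h =>
      PartialOrder.ext fun x y => by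
        have := congrFun (congrFun h x) y
        exact iff_of_eq this
  let I := {o : PartialOrder (Fin n) // ∀ u v w : Fin n,
    o.le u w → o.le v w → o.le u v ∨ o.le v u}
  let toForest : I → FinForest := fun o =>
    { V := Fin n, orderV := o.1, ancestors_chain := o.2 }
  let F : I → OfDegree n := fun o =>
    ⟨mk (toForest o), by
      change Fintype.card (Fin n) = n
      simp⟩
  refine Finite.of_surjective F ?_
  rintro ⟨⟨P⟩, hP⟩
  let e : P.V ≃ Fin n := Fintype.equivFinOfCardEq hP
  let o : PartialOrder (Fin n) := PartialOrder.lift e.symm e.symm.injective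
  refine ⟨⟨o, fun u v w h₁ h₂ => P.ancestors_chain _ _ _ h₁ h₂⟩, Subtype.ext ?_⟩
  refine mk_eq_of_iso (P := toForest _) (Q := P) ?_
  exact { toEquiv := e.symm, map_rel_iff' := Iff.rfl }

instance fintype_ofDegree (n : ℕ) : Fintype (OfDegree n) := Fintype.ofFinite _

instance decidableEq_ofDegree (n : ℕ) : DecidableEq (OfDegree n) := Classical.decEq _

end RootedForest

open RootedForest ConnesKreimer

/-- The transition matrix of the trinomial-top-or-bottom-to-random chain on rooted forests with `n`
vertices: `K(x, y) = (η(y) / η(x)) · (coefficient of y in the operator applied to x)`. -/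
def trintoberMatrix (n : ℕ) (q₁ q₂ q₃ : ℝ) : Matrix (OfDegree n) (OfDegree n) ℝ := fun x y =>
  eta n (MonoidAlgebra.single y.1 1) / eta n (MonoidAlgebra.single x.1 1) *
    (trintober n q₁ q₂ q₃ (MonoidAlgebra.single x.1 1)).coeff y.1

/-- The expected value `E(f(X_t) | X_0 = x₀) = ∑_y K^t(x₀, y) f(y)` for a Markov chain `X` with
transition matrix `K`. -/
def expectedValue {Ω : Type*} [Fintype Ω] [DecidableEq Ω] (K : Matrix Ω Ω ℝ) (x₀ : Ω) (t : ℕ)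
    (f : Ω → ℝ) : ℝ := ∑ y, (K ^ t) x₀ y * f y

/-- The function
`x ↦ ∑_{u ∈ x} binom(h(u), n₀ - j) (q₃ / (q₁ + q₃))^(a(u) - 1) (q₁ / (q₁ + q₃))^h(u)`. -/
def fTilde (n₀ j : ℕ) (q₁ q₃ : ℝ) : RootedForest → ℝ :=
  Quotient.lift
    (fun P : FinForest => ∑ u : P.V, ((P.hook u).choose (n₀ - j) : ℝ) *
      (q₃ / (q₁ + q₃)) ^ (P.anc u - 1) * (q₁ / (q₁ + q₃)) ^ P.hook u)
    (by
      rintro P Q ⟨e⟩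
      refine Fintype.sum_equiv e.toEquiv _ _ fun u => ?_
      have h₁ : Q.hook (e.toEquiv u) = P.hook u := FinForest.hook_congr e u
      have h₂ : Q.anc (e.toEquiv u) = P.anc u := FinForest.anc_congr e u
      rw [h₁, h₂])

/-- The maximum of `binom(n₀, a(u) - 1)` over the vertices `u` of `x` with `h(u) ≥ n₀ - j`
(and `0` if there is no such vertex). -/
def maxChoose (n₀ j : ℕ) : RootedForest → ℕ :=
  Quotient.lift
    (fun P : FinForest => (Finset.univ.filter fun u : P.V => n₀ - j ≤ P.hook u).sup
      fun u => n₀.choose (P.anc u - 1))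
    (by
      rintro P Q ⟨e⟩
      apply le_antisymm
      · refine Finset.sup_le fun u hu => ?_
        rw [← FinForest.anc_congr e u]
        refine Finset.le_sup (f := fun u => n₀.choose (Q.anc u - 1)) (b := e u) ?_
        simpa [FinForest.hook_congr e u] using hu
      · refine Finset.sup_le fun u hu => ?_
        rw [← FinForest.anc_congr e.symm u]
        refine Finset.le_sup (f := fun u => n₀.choose (P.anc u - 1)) (b := e.symm u) ?_
        simpa [FinForest.hook_congr e.symm u] using hu)

end

/-! Fix a concrete forest and work with functions on its vertex sets under convolution over trunks,
`conv`, which mirrors the coproduct. Let `weight U` be the inverse product of hook sizes in `U`. The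
functions `q ^ |U| * weight U` form a one-parameter convolution semigroup
(`scaledWeight_conv_scaledWeight`), the exponential series of the one-vertex function. Hence the
operator is `expFn q₁ * dilFn q₂ * expFn q₃` (`trintober_basisOn`). It is multiplicative on disjoint
unions and fixes the one-vertex forest, so operators of this type compose within their family
(`trintober_trintFn`). With a = q₃/(q₁+q₃) and b = q₁/(q₁+q₃), K^t is therefore a single step with
parameters b(1-s), s, a(1-s), where s = q₂^t (`trintoberMatrix_pow`).

For one step the expectation is a sum over vertices u of double convolutions
(`sum_trintoberMatrix_mul_fTilde`). Differentiating a factor q ^ |U| * weight U in q removes a root,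
so each contribution satisfies a triangular system of differential equations indexed by vertex sets.
A comparison argument by induction on the size of the set (`le_boundFn`) bounds it. The argument is
applied twice, first in the parameter of the surviving part and then in that of the part removed at
the roots. For the parameters above, the bound for u collapses to s^D times its initial contribution
times a binomial coefficient, with D = n₀ - j. -/

noncomputable section

/-! ### Convolution over trunks of vertex sets. -/

namespace FinForest

open scoped Classical

variable (P : FinForest)

/-- The subsets of `U` that are closed under taking ancestors in `U`. -/
def trunksIn (U : Finset P.V) : Finset (Finset P.V) :=
  U.powerset.filter fun B => ∀ b ∈ B, ∀ a ∈ U, a ≤ b → a ∈ B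

variable {P}

theorem mem_trunksIn {U B : Finset P.V} :
    B ∈ P.trunksIn U ↔ B ⊆ U ∧ ∀ b ∈ B, ∀ a ∈ U, a ≤ b → a ∈ B := by
  simp [trunksIn]

/-- The convolution product of functions on the sets of vertices of a forest. -/
def conv {A : Type*} [Semiring A] (F G : Finset P.V → A) (U : Finset P.V) : A :=
  ∑ B ∈ P.trunksIn U, F (U \ B) * G B

/-- The unit of the convolution product. -/
def convOne (A : Type*) [Semiring A] (U : Finset P.V) : A := if U = ∅ then 1 else 0

section

variable {A : Type*} [Semiring A]

theorem convOne_conv (F : Finset P.V → A) : conv (convOne A) F = F := by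
  funext U
  unfold conv convOne
  rw [Finset.sum_eq_single U]
  · simp
  · intro B hB hBU
    rw [if_neg, zero_mul]
    intro h
    exact hBU (Finset.Subset.antisymm (mem_trunksIn.1 hB).1 (Finset.sdiff_eq_empty_iff_subset.1 h))
  · intro h
    exact absurd (mem_trunksIn.2 ⟨subset_rfl, fun _ _ a ha _ => ha⟩) h

theorem conv_convOne (F : Finset P.V → A) : conv F (convOne A) = F := by
  funext U
  unfold conv convOne
  rw [Finset.sum_eq_single ∅]
  · simp
  · intro B _ hB
    rw [if_neg hB, mul_zero]
  · intro h
    exact absurd (mem_trunksIn.2 ⟨by simp, by simp⟩) h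

/-- Both sides sum over chains of two trunks: a trunk B followed by a trunk C of the complement
corresponds to the trunk B ∪ C with its subtrunk B. -/
theorem conv_assoc (F G H : Finset P.V → A) : conv (conv F G) H = conv F (conv G H) := by
  funext U
  unfold conv
  simp only [Finset.sum_mul, Finset.mul_sum]
  rw [Finset.sum_sigma', Finset.sum_sigma']
  refine Finset.sum_bij' (fun p _ => ⟨p.1 ∪ p.2, p.1⟩) (fun p _ => ⟨p.2, p.1 \ p.2⟩) ?_ ?_ ?_ ?_ ?_
  · rintro ⟨B, C⟩ h
    simp only [Finset.mem_sigma, mem_trunksIn] at h ⊢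
    obtain ⟨⟨hB, hB'⟩, hC, hC'⟩ := h
    refine ⟨⟨Finset.union_subset hB (hC.trans Finset.sdiff_subset), ?_⟩,
      Finset.subset_union_left, ?_⟩
    · intro b hb a ha hab
      rw [Finset.mem_union] at hb ⊢
      by_cases haB : a ∈ B
      · exact Or.inl haB
      · rcases hb with hb | hb
        · exact Or.inl (hB' b hb a ha hab)
        · exact Or.inr (hC' b hb a (Finset.mem_sdiff.2 ⟨ha, haB⟩) hab)
    · intro b hb a ha hab
      refine hB' b hb a ?_ hab
      rcases Finset.mem_union.1 ha with ha | ha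
      · exact hB ha
      · exact (Finset.mem_sdiff.1 (hC ha)).1
  · rintro ⟨B, C⟩ h
    simp only [Finset.mem_sigma, mem_trunksIn] at h ⊢
    obtain ⟨⟨hB, hB'⟩, hC, hC'⟩ := h
    refine ⟨⟨hC.trans hB, fun b hb a ha hab => hC' b hb a (hB' b (hC hb) a ha hab) hab⟩,
      Finset.sdiff_subset_sdiff hB subset_rfl, ?_⟩
    intro b hb a ha hab
    rw [Finset.mem_sdiff] at ha hb ⊢
    exact ⟨hB' b hb.1 a ha.1 hab, ha.2⟩
  · rintro ⟨B, C⟩ h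
    simp only [Finset.mem_sigma, mem_trunksIn] at h
    simp only [Sigma.mk.injEq, heq_eq_eq, true_and]
    ext x
    have hs := h.2.1
    have := @hs x
    simp only [Finset.mem_sdiff, Finset.mem_union] at this ⊢
    tauto
  · rintro ⟨B, C⟩ h
    simp only [Finset.mem_sigma, mem_trunksIn] at h
    simp only [Sigma.mk.injEq, heq_eq_eq, and_true]
    exact Finset.union_sdiff_of_subset h.2.1
  · rintro ⟨B, C⟩ h
    simp only [Finset.mem_sigma, mem_trunksIn] at h
    have h1 : (B ∪ C) \ B = C := by
      ext x
      have hs := h.2.1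
      have := @hs x
      simp only [Finset.mem_sdiff, Finset.mem_union] at this ⊢
      tauto
    simp only [h1, Finset.sdiff_sdiff_left', mul_assoc]
    congr 2
    ext x
    simp only [Finset.mem_sdiff, Finset.mem_union, Finset.mem_inter]
    tauto

end

/-- A trunk of a union of mutually incomparable sets is an arbitrary pair of trunks, so the sum
factors. -/
theorem conv_union {A : Type*} [CommSemiring A] {F F₁ F₂ G G₁ G₂ : Finset P.V → A}
    {U₁ U₂ : Finset P.V} (hd : Disjoint U₁ U₂) (hU : ∀ a ∈ U₁, ∀ b ∈ U₂, ¬ a ≤ b ∧ ¬ b ≤ a)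
    (hF : ∀ X₁ ⊆ U₁, ∀ X₂ ⊆ U₂, F (X₁ ∪ X₂) = F₁ X₁ * F₂ X₂)
    (hG : ∀ X₁ ⊆ U₁, ∀ X₂ ⊆ U₂, G (X₁ ∪ X₂) = G₁ X₁ * G₂ X₂) :
    conv F G (U₁ ∪ U₂) = conv F₁ G₁ U₁ * conv F₂ G₂ U₂ := by
  unfold conv
  rw [Finset.sum_mul_sum, ← Finset.sum_product']
  symm
  refine Finset.sum_bij' (fun p _ => p.1 ∪ p.2) (fun B _ => (B ∩ U₁, B ∩ U₂)) ?_ ?_ ?_ ?_ ?_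
  · rintro ⟨B, C⟩ h
    simp only [Finset.mem_product, mem_trunksIn] at h ⊢
    obtain ⟨⟨hB, hB'⟩, hC, hC'⟩ := h
    refine ⟨Finset.union_subset_union hB hC, ?_⟩
    intro b hb a ha hab
    rw [Finset.mem_union] at ha hb ⊢
    rcases hb with hb | hb <;> rcases ha with ha | ha
    · exact Or.inl (hB' b hb a ha hab)
    · exact absurd hab (hU b (hB hb) a ha).2
    · exact absurd hab (hU a ha b (hC hb)).1
    · exact Or.inr (hC' b hb a ha hab)
  · intro B h
    simp only [Finset.mem_product, mem_trunksIn] at h ⊢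
    refine ⟨⟨Finset.inter_subset_right, ?_⟩, Finset.inter_subset_right, ?_⟩
    · intro b hb a ha hab
      rw [Finset.mem_inter] at hb ⊢
      exact ⟨h.2 b hb.1 a (Finset.mem_union_left _ ha) hab, ha⟩
    · intro b hb a ha hab
      rw [Finset.mem_inter] at hb ⊢
      exact ⟨h.2 b hb.1 a (Finset.mem_union_right _ ha) hab, ha⟩
  · rintro ⟨B, C⟩ h
    simp only [Finset.mem_product, mem_trunksIn] at h
    have h1 := h.1.1
    have h2 := h.2.1
    have hd' := Finset.disjoint_left.1 hd
    simp only [Prod.mk.injEq]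
    constructor <;> ext x <;> have h1 := @h1 x <;> have h2 := @h2 x <;> have hd' := @hd' x <;>
      simp only [Finset.mem_inter, Finset.mem_union] <;> tauto
  · intro B h
    rw [mem_trunksIn] at h
    rw [← Finset.inter_union_distrib_left]
    exact Finset.inter_eq_left.2 h.1
  · rintro ⟨B, C⟩ h
    simp only [Finset.mem_product, mem_trunksIn] at h
    have h1 := h.1.1
    have h2 := h.2.1
    have hd' := Finset.disjoint_left.1 hd
    have key : (U₁ ∪ U₂) \ (B ∪ C) = (U₁ \ B) ∪ (U₂ \ C) := by
      ext x
      have h1 := @h1 x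
      have h2 := @h2 x
      have hd' := @hd' x
      simp only [Finset.mem_sdiff, Finset.mem_union]
      tauto
    rw [key, hF _ Finset.sdiff_subset _ Finset.sdiff_subset, hG _ h1 _ h2]
    ring

/-! ### Roots, hooks and the inverse hook product. -/

variable (P) in
/-- The roots of the forest induced on `U`. -/
def rootsIn (U : Finset P.V) : Finset P.V := U.filter fun r => ∀ a ∈ U, a ≤ r → a = r

theorem mem_rootsIn {U : Finset P.V} {r : P.V} :
    r ∈ P.rootsIn U ↔ r ∈ U ∧ ∀ a ∈ U, a ≤ r → a = r := by
  simp [rootsIn]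

/-- The function supported on one-vertex sets with constant value `c`. -/
def pointFn {A : Type*} [Semiring A] (c : A) (U : Finset P.V) : A := if U.card = 1 then c else 0

/-- The one-element trunks are exactly the roots. -/
theorem conv_pointFn {A : Type*} [Semiring A] (F : Finset P.V → A) (c : A) (U : Finset P.V) :
    conv F (pointFn c) U = ∑ r ∈ P.rootsIn U, F (U.erase r) * c := by
  unfold conv pointFn
  simp only [mul_ite, mul_zero]
  rw [← Finset.sum_filter]
  symm
  refine Finset.sum_bij (fun r _ => {r}) ?_ ?_ ?_ ?_
  · intro r hr
    rw [mem_rootsIn] at hr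
    rw [Finset.mem_filter, mem_trunksIn]
    refine ⟨⟨by simpa using hr.1, ?_⟩, by simp⟩
    intro b hb a ha hab
    rw [Finset.mem_singleton] at hb ⊢
    subst hb
    exact hr.2 a ha hab
  · intro r _ s _ h
    simpa using h
  · intro B hB
    rw [Finset.mem_filter, mem_trunksIn] at hB
    obtain ⟨r, rfl⟩ := Finset.card_eq_one.1 hB.2
    refine ⟨r, mem_rootsIn.2 ⟨by simpa using hB.1.1, ?_⟩, rfl⟩
    intro a ha har
    simpa using hB.1.2 r (by simp) a ha har
  · intro r _
    rw [Finset.erase_eq]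

variable (P) in
/-- The size of the hook of `u` in the forest induced on `U`. -/
def hookIn (U : Finset P.V) (u : P.V) : ℕ := (U.filter fun v => u ≤ v).card

variable (P) in
/-- The number of ancestors of `u` in the forest induced on `U`. -/
def ancIn (U : Finset P.V) (u : P.V) : ℕ := (U.filter fun v => v ≤ u).card

variable (P) in
/-- The inverse of the product of the hook sizes in the forest induced on `U`. -/
def weight (U : Finset P.V) : ℝ := ∏ u ∈ U, (P.hookIn U u : ℝ)⁻¹

theorem weight_nonneg (U : Finset P.V) : 0 ≤ P.weight U :=
  Finset.prod_nonneg fun _ _ => by positivity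

theorem hookIn_pos {U : Finset P.V} {u : P.V} (hu : u ∈ U) : 0 < P.hookIn U u :=
  Finset.card_pos.2 ⟨u, by simp [hu]⟩

theorem weight_pos (U : Finset P.V) : 0 < P.weight U :=
  Finset.prod_pos fun u hu => by
    have := hookIn_pos hu
    positivity

theorem ancIn_pos {U : Finset P.V} {u : P.V} (hu : u ∈ U) : 0 < P.ancIn U u :=
  Finset.card_pos.2 ⟨u, by simp [hu]⟩

theorem hookIn_erase {U : Finset P.V} {r u : P.V} (hr : r ∈ P.rootsIn U) (hu : u ∈ U)
    (hne : u ≠ r) : P.hookIn (U.erase r) u = P.hookIn U u := by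
  unfold hookIn
  congr 1
  ext v
  simp only [Finset.mem_filter, Finset.mem_erase]
  constructor
  · tauto
  · rintro ⟨h1, h2⟩
    refine ⟨⟨?_, h1⟩, h2⟩
    rintro rfl
    exact hne ((mem_rootsIn.1 hr).2 u hu h2)

/-- A root lies in no hook but its own, so deleting it only drops its own factor. -/
theorem weight_erase {U : Finset P.V} {r : P.V} (hr : r ∈ P.rootsIn U) :
    P.weight (U.erase r) = P.hookIn U r * P.weight U := by
  have hrU := (mem_rootsIn.1 hr).1
  unfold weight
  rw [← Finset.mul_prod_erase U _ hrU, mul_inv_cancel_left₀]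
  · refine Finset.prod_congr rfl fun u hu => ?_
    rw [Finset.mem_erase] at hu
    rw [hookIn_erase hr hu.2 hu.1]
  · exact_mod_cast (hookIn_pos hrU).ne'

theorem exists_root_le {U : Finset P.V} {u : P.V} (hu : u ∈ U) : ∃ r ∈ P.rootsIn U, r ≤ u := by
  obtain ⟨r, hr, hmin⟩ := (U.filter fun v => v ≤ u).exists_minimal ⟨u, by simp [hu]⟩
  rw [Finset.mem_filter] at hr
  refine ⟨r, mem_rootsIn.2 ⟨hr.1, fun a ha har => ?_⟩, hr.2⟩
  exact le_antisymm har (hmin (Finset.mem_filter.2 ⟨ha, har.trans hr.2⟩) har)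

/-- The chain condition on ancestors enters the combinatorics here; it makes the hooks of distinct
roots disjoint. -/
theorem root_le_of_le {U : Finset P.V} {r u v : P.V} (hr : r ∈ P.rootsIn U) (hv : v ∈ U)
    (hru : r ≤ u) (hvu : v ≤ u) : r ≤ v := by
  rcases P.ancestors_chain r v u hru hvu with h | h
  · exact h
  · rw [(mem_rootsIn.1 hr).2 v hv h]

theorem sum_hookIn_roots (U : Finset P.V) : ∑ r ∈ P.rootsIn U, P.hookIn U r = U.card := by
  unfold hookIn
  rw [← Finset.card_biUnion]
  · congr 1
    ext v
    simp only [Finset.mem_biUnion, Finset.mem_filter]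
    constructor
    · rintro ⟨_, _, h, _⟩
      exact h
    · intro hv
      obtain ⟨r, hr, hrv⟩ := exists_root_le hv
      exact ⟨r, hr, hv, hrv⟩
  · intro r hr s hs hrs
    rw [Function.onFun, Finset.disjoint_left]
    intro v hv hv'
    rw [Finset.mem_filter] at hv hv'
    exact hrs (((mem_rootsIn.1 hs).2 r (mem_rootsIn.1 hr).1
      (root_le_of_le hr (mem_rootsIn.1 hs).1 hv.2 hv'.2)))

/-- The hooks of the roots partition `U`. This is the recursion behind the hook length formula. -/
theorem sum_weight_erase (U : Finset P.V) :
    ∑ r ∈ P.rootsIn U, P.weight (U.erase r) = U.card * P.weight U := by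
  rw [← sum_hookIn_roots, Nat.cast_sum, Finset.sum_mul]
  exact Finset.sum_congr rfl fun r hr => weight_erase hr

/-- Up to m!, the restriction of `weight` to sets of size m is the m-th convolution power of the
one-vertex function. Each such factor removes one root, which multiplies by the current cardinality.
-/
theorem sum_weight_mul_weight (m : ℕ) (U : Finset P.V) :
    ∑ S ∈ P.trunksIn U with S.card = m, P.weight (U \ S) * P.weight S =
      U.card.choose m * P.weight U := by
  let w : ℕ → Finset P.V → ℝ := fun m S => if S.card = m then P.weight S else 0
  have hw : ∀ m, (fun S => ((m + 1 : ℕ) : ℝ) * w (m + 1) S) = conv (w m) (pointFn (1 : ℝ)) := by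
    intro m
    funext S
    rw [conv_pointFn]
    by_cases h : S.card = m + 1
    · simp only [w, h, if_true, mul_one]
      rw [← h, ← sum_weight_erase]
      refine Finset.sum_congr rfl fun r hr => ?_
      rw [if_pos]
      rw [Finset.card_erase_of_mem (mem_rootsIn.1 hr).1, h]
      rfl
    · simp only [w, h, if_false, mul_one, mul_zero]
      symm
      refine Finset.sum_eq_zero fun r hr => ?_
      rw [if_neg]
      have := Finset.card_erase_add_one (mem_rootsIn.1 hr).1
      omega
  have key : ∀ m U, conv P.weight (w m) U = U.card.choose m * P.weight U := by
    intro m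
    induction m with
    | zero =>
      intro U
      have : w 0 = convOne ℝ := by
        funext S
        by_cases h : S = ∅
        · subst h
          simp [w, convOne, weight]
        · simp [w, convOne, h]
      rw [this, conv_convOne]
      simp
    | succ m ih =>
      intro U
      have h0 : ((m + 1 : ℕ) : ℝ) ≠ 0 := by positivity
      apply mul_left_cancel₀ h0
      have h1 : ((m + 1 : ℕ) : ℝ) * conv P.weight (w (m + 1)) U =
          conv P.weight (fun S => ((m + 1 : ℕ) : ℝ) * w (m + 1) S) U := by
        unfold conv
        rw [Finset.mul_sum]
        exact Finset.sum_congr rfl fun B _ => by ring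
      rw [h1, hw, ← conv_assoc, conv_pointFn]
      have h2 : ∀ r ∈ P.rootsIn U, conv P.weight (w m) (U.erase r) * 1 =
          (U.card - 1).choose m * P.weight (U.erase r) := by
        intro r hr
        rw [ih, Finset.card_erase_of_mem (mem_rootsIn.1 hr).1, mul_one]
      rw [Finset.sum_congr rfl h2, ← Finset.mul_sum, sum_weight_erase]
      rcases Nat.eq_zero_or_pos U.card with h | h
      · simp [h]
      · obtain ⟨n, hn⟩ := Nat.exists_eq_succ_of_ne_zero h.ne'
        have := Nat.add_one_mul_choose_eq n m
        rw [hn]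
        simp only [Nat.succ_eq_add_one, Nat.add_sub_cancel]
        have h3 : ((n + 1 : ℕ) : ℝ) * n.choose m = (n + 1).choose (m + 1) * ((m + 1 : ℕ) : ℝ) := by
          exact_mod_cast this
        linear_combination P.weight U * h3
  rw [← key, conv, Finset.sum_filter]
  exact Finset.sum_congr rfl fun S _ => by simp [w]

theorem sum_weight_mul_weight_card (g : ℕ → ℝ) (U : Finset P.V) :
    ∑ S ∈ P.trunksIn U, g S.card * (P.weight (U \ S) * P.weight S) =
      (∑ m ∈ Finset.range (U.card + 1), g m * U.card.choose m) * P.weight U := by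
  rw [← Finset.sum_fiberwise_of_maps_to (g := Finset.card) (t := Finset.range (U.card + 1)),
    Finset.sum_mul]
  · refine Finset.sum_congr rfl fun m _ => ?_
    rw [mul_assoc, ← sum_weight_mul_weight, Finset.mul_sum]
    exact Finset.sum_congr rfl fun S hS => by rw [(Finset.mem_filter.1 hS).2]
  · intro S hS
    rw [Finset.mem_range]
    have := Finset.card_le_card (mem_trunksIn.1 hS).1
    omega

theorem weight_union {U₁ U₂ : Finset P.V} (hd : Disjoint U₁ U₂)
    (hU : ∀ a ∈ U₁, ∀ b ∈ U₂, ¬ a ≤ b ∧ ¬ b ≤ a) :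
    P.weight (U₁ ∪ U₂) = P.weight U₁ * P.weight U₂ := by
  unfold weight
  rw [Finset.prod_union hd]
  congr 1 <;> refine Finset.prod_congr rfl fun u hu => ?_ <;> congr 2 <;> unfold hookIn <;>
    congr 1 <;> rw [Finset.filter_union]
  · rw [Finset.union_eq_left.2]
    intro b hb
    rw [Finset.mem_filter] at hb
    exact absurd hb.2 (hU u hu b hb.1).1
  · rw [Finset.union_eq_right.2]
    intro b hb
    rw [Finset.mem_filter] at hb
    exact absurd hb.2 (hU b hb.1 u hu).2

/-! ### The exponential semigroup and its derivative. -/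

/-- `U ↦ q ^ |U| / ∏ h(u)`, where the product is over the vertices of `U`. -/
def scaledWeight (q : ℝ) (U : Finset P.V) : ℝ := q ^ U.card * P.weight U

theorem scaledWeight_zero : scaledWeight 0 = convOne (P := P) ℝ := by
  funext U
  by_cases h : U = ∅
  · simp [scaledWeight, convOne, h, weight]
  · simp [scaledWeight, convOne, h]

theorem scaledWeight_union (q : ℝ) {U₁ U₂ : Finset P.V} (hd : Disjoint U₁ U₂)
    (hU : ∀ a ∈ U₁, ∀ b ∈ U₂, ¬ a ≤ b ∧ ¬ b ≤ a) :
    scaledWeight q (U₁ ∪ U₂) = scaledWeight q U₁ * scaledWeight q U₂ := by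
  unfold scaledWeight
  rw [weight_union hd hU, Finset.card_union_of_disjoint hd, pow_add]
  ring

theorem conv_scaledWeight_mul_card (g : ℕ → ℝ) (p q : ℝ) (U : Finset P.V) :
    conv (scaledWeight p) (fun S => scaledWeight q S * g S.card) U =
      (∑ m ∈ Finset.range (U.card + 1), q ^ m * p ^ (U.card - m) * U.card.choose m * g m) *
        P.weight U := by
  have h := sum_weight_mul_weight_card (fun m => q ^ m * p ^ (U.card - m) * g m) U
  rw [show (∑ m ∈ Finset.range (U.card + 1), q ^ m * p ^ (U.card - m) * U.card.choose m * g m) =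
    ∑ m ∈ Finset.range (U.card + 1), q ^ m * p ^ (U.card - m) * g m * U.card.choose m from
    Finset.sum_congr rfl fun m _ => by ring, ← h]
  unfold conv scaledWeight
  refine Finset.sum_congr rfl fun S hS => ?_
  rw [Finset.card_sdiff_of_subset (mem_trunksIn.1 hS).1]
  ring

theorem scaledWeight_conv_scaledWeight (p q : ℝ) :
    conv (scaledWeight p) (scaledWeight q) = scaledWeight (P := P) (p + q) := by
  funext U
  have h := conv_scaledWeight_mul_card (fun _ => 1) p q U
  simp only [mul_one] at h
  rw [h, scaledWeight, add_comm p, add_pow]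

/-- The one-vertex function is the infinitesimal generator of the semigroup. -/
theorem hasDerivAt_scaledWeight (q : ℝ) (U : Finset P.V) :
    HasDerivAt (fun q => scaledWeight q U) (conv (scaledWeight q) (pointFn 1) U) q := by
  have h : conv (scaledWeight q) (pointFn 1) U = U.card * q ^ (U.card - 1) * P.weight U := by
    rw [conv_pointFn, mul_right_comm, ← sum_weight_erase, Finset.sum_mul]
    refine Finset.sum_congr rfl fun r hr => ?_
    rw [scaledWeight, Finset.card_erase_of_mem (mem_rootsIn.1 hr).1]
    ring
  rw [h]
  exact (hasDerivAt_pow _ _).mul_const _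

/-- By associativity, an evolution of the right factor by the generator carries over to the whole
convolution; the result is the differential system used in the comparison argument. -/
theorem hasDerivAt_conv {F : Finset P.V → ℝ} {G : ℝ → Finset P.V → ℝ} {q : ℝ} {U : Finset P.V}
    (hG : ∀ S ∈ P.trunksIn U,
      HasDerivAt (fun q => G q S) (conv (G q) (pointFn 1) S) q) :
    HasDerivAt (fun q => conv F (G q) U) (∑ r ∈ P.rootsIn U, conv F (G q) (U.erase r)) q := by
  have h : ∑ r ∈ P.rootsIn U, conv F (G q) (U.erase r) =
      conv F (conv (G q) (pointFn 1)) U := by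
    rw [← conv_assoc, conv_pointFn]
    exact Finset.sum_congr rfl fun r _ => (mul_one _).symm
  rw [h]
  exact HasDerivAt.fun_sum fun S hS => (hG S hS).const_mul _

end FinForest

/-! ### The Hopf algebra operators as convolutions. -/

namespace FinForest

open scoped Classical
open ConnesKreimer

variable {P : FinForest}

variable (P) in
/-- The basis element of the Connes-Kreimer algebra given by the forest induced on `U`. -/
def basisOn (U : Finset P.V) : ConnesKreimer :=
  MonoidAlgebra.single (RootedForest.mk (P.restrict U)) 1

theorem restrict_degree (U : Finset P.V) : (P.restrict U).degree = U.card := by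
  unfold degree
  rw [← Fintype.card_coe U]
  exact Fintype.card_congr (Equiv.refl _)

/-- The forest induced on the set of all vertices. -/
def restrictUniv (P : FinForest) : (P.restrict Finset.univ).V ≃o P.V where
  toEquiv := Equiv.subtypeUnivEquiv fun _ => Finset.mem_univ _
  map_rel_iff' := Iff.rfl

theorem mk_restrict_univ (P : FinForest) :
    RootedForest.mk (P.restrict Finset.univ) = RootedForest.mk P :=
  RootedForest.mk_eq_of_iso (restrictUniv P)

theorem liftBasis_single {A : Type*} [AddCommMonoid A] [Module ℝ A] (f : RootedForest → A)
    (x : RootedForest) (c : ℝ) : liftBasis f (MonoidAlgebra.single x c) = c • f x := by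
  simp [liftBasis]

theorem liftBasis_basisOn {A : Type*} [AddCommMonoid A] [Module ℝ A] (f : RootedForest → A)
    (U : Finset P.V) : liftBasis f (P.basisOn U) = f (RootedForest.mk (P.restrict U)) := by
  rw [basisOn, liftBasis_single, one_smul]

theorem mk_restrict_restrict (U : Finset P.V) (S : Finset (P.restrict U).V) (B : Finset P.V)
    (h : ∀ v : (P.restrict U).V, v ∈ S ↔ v.1 ∈ B) (hB : B ⊆ U) :
    RootedForest.mk ((P.restrict U).restrict S) = RootedForest.mk (P.restrict B) :=
  RootedForest.mk_eq_of_iso (P := (P.restrict U).restrict S) (Q := P.restrict B)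
    { toFun := fun v => ⟨v.1.1, (h v.1).1 v.2⟩
      invFun := fun v => ⟨⟨v.1, hB v.2⟩, (h ⟨v.1, hB v.2⟩).2 v.2⟩
      left_inv := fun _ => rfl
      right_inv := fun _ => rfl
      map_rel_iff' := Iff.rfl }

theorem comul_basisOn (U : Finset P.V) :
    comul (P.basisOn U) = ∑ B ∈ P.trunksIn U, P.basisOn (U \ B) ⊗ₜ[ℝ] P.basisOn B := by
  refine (liftBasis_basisOn _ U).trans ?_
  change forestComul (P.restrict U) = _
  unfold forestComul
  refine Finset.sum_bij'
    (fun S _ => (S.image fun v : (P.restrict U).V => v.1 : Finset P.V))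
    (fun B _ => (Finset.univ.filter fun v : (P.restrict U).V => v.1 ∈ B)) ?_ ?_ ?_ ?_ ?_
  · intro S hS
    simp only [trunks, Finset.mem_filter, Finset.mem_univ, true_and] at hS
    rw [mem_trunksIn]
    constructor
    · intro b hb
      obtain ⟨v, _, rfl⟩ := Finset.mem_image.1 hb
      exact v.2
    · intro b hb a ha hab
      obtain ⟨v, hv, rfl⟩ := Finset.mem_image.1 hb
      exact Finset.mem_image.2 ⟨⟨a, ha⟩, hS (a := v) (b := ⟨a, ha⟩) hab hv, rfl⟩
  · intro B hB
    rw [mem_trunksIn] at hB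
    simp only [trunks, Finset.mem_filter, Finset.mem_univ, true_and]
    intro v w hwv hv
    simp only [Finset.coe_filter, Finset.mem_univ, true_and, Set.mem_ofPred_eq] at hv ⊢
    exact hB.2 v.1 hv w.1 w.2 hwv
  · intro S _
    ext v
    simp only [Finset.mem_filter, Finset.mem_univ, true_and, Finset.mem_image]
    exact ⟨fun ⟨w, hw, h⟩ => (Subtype.ext h : w = v) ▸ hw, fun h => ⟨v, h, rfl⟩⟩
  · intro B hB
    rw [mem_trunksIn] at hB
    ext b
    simp only [Finset.mem_filter, Finset.mem_univ, true_and, Finset.mem_image]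
    exact ⟨fun ⟨w, hw, h⟩ => h ▸ hw, fun h => ⟨⟨b, hB.1 h⟩, h, rfl⟩⟩
  · intro S _
    have h1 : ∀ v : (P.restrict U).V,
        v ∈ S ↔ v.1 ∈ (S.image fun v : (P.restrict U).V => v.1 : Finset P.V) := by
      intro v
      rw [Finset.mem_image]
      exact ⟨fun h => ⟨v, h, rfl⟩, fun ⟨w, hw, h⟩ => (Subtype.ext h : w = v) ▸ hw⟩
    have h2 : (S.image fun v : (P.restrict U).V => v.1 : Finset P.V) ⊆ U := by
      intro b hb
      obtain ⟨v, _, rfl⟩ := Finset.mem_image.1 hb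
      exact v.2
    unfold basisOn
    rw [mk_restrict_restrict U S _ h1 h2, mk_restrict_restrict U Sᶜ (U \ _) _ Finset.sdiff_subset]
    intro v
    rw [Finset.mem_compl, Finset.mem_sdiff, h1]
    exact ⟨fun h => ⟨v.2, h⟩, fun h => h.2⟩

section

variable {A : Type*} [Ring A] [Algebra ℝ A]

/-- The coproduct of an induced forest is again a sum over induced forests of the same ambient
forest, so iterated coproducts need no passage to isomorphism classes. -/
theorem mulComp_basisOn (F : List (ConnesKreimer →ₗ[ℝ] A)) (U : Finset P.V) :
    mulComp F (P.basisOn U) =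
      (F.map fun f S => f (P.basisOn S)).foldl conv (convOne A) U := by
  have key : ∀ (F : List (ConnesKreimer →ₗ[ℝ] A)) (G : ConnesKreimer →ₗ[ℝ] A)
      (g : Finset P.V → A), (∀ U, G (P.basisOn U) = g U) → ∀ U,
      F.foldl (fun G f => LinearMap.mul' ℝ A ∘ₗ TensorProduct.map G f ∘ₗ comul) G (P.basisOn U) =
        (F.map fun f S => f (P.basisOn S)).foldl conv g U := by
    intro F
    induction F with
    | nil => intro G g h U; exact h U
    | cons f F ih =>
      intro G g h U
      simp only [List.foldl_cons, List.map_cons]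
      apply ih
      intro U
      simp [comul_basisOn, conv, h]
  refine key F _ _ (fun U => ?_) U
  simp only [LinearMap.comp_apply, counit, liftBasis_basisOn]
  change algebraMap ℝ A (if (P.restrict U).degree = 0 then 1 else 0) = _
  rw [restrict_degree]
  by_cases h : U = ∅
  · simp [h, convOne]
  · simp [h, convOne]

/-- The `r`-th convolution power of `pointFn c`. -/
def powFn (c : A) (r : ℕ) (U : Finset P.V) : A :=
  if U.card = r then ((r.factorial : ℝ) * P.weight U) • c ^ r else 0

theorem powFn_zero (c : A) : powFn c 0 = convOne (P := P) A := by
  funext U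
  by_cases h : U = ∅
  · simp [powFn, convOne, h, weight]
  · simp [powFn, convOne, h]

theorem powFn_conv_pointFn (c : A) (r : ℕ) :
    conv (powFn c r) (pointFn c) = powFn (P := P) c (r + 1) := by
  funext U
  rw [conv_pointFn]
  unfold powFn
  by_cases h : U.card = r + 1
  · rw [if_pos h]
    have : ∀ s ∈ P.rootsIn U, (if (U.erase s).card = r then
        ((r.factorial : ℝ) * P.weight (U.erase s)) • c ^ r else 0) * c =
        (P.weight (U.erase s)) • ((r.factorial : ℝ) • c ^ (r + 1)) := by
      intro s hs
      rw [if_pos (by rw [Finset.card_erase_of_mem (mem_rootsIn.1 hs).1, h]; rfl)]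
      rw [smul_mul_assoc, ← pow_succ, smul_smul, mul_comm]
    rw [Finset.sum_congr rfl this, ← Finset.sum_smul, sum_weight_erase, smul_smul, h]
    congr 1
    rw [Nat.factorial_succ]
    push_cast
    ring
  · rw [if_neg h]
    refine Finset.sum_eq_zero fun s hs => ?_
    rw [if_neg, zero_mul]
    have := Finset.card_erase_add_one (mem_rootsIn.1 hs).1
    omega

theorem foldl_conv_replicate (G : Finset P.V → A) (c : A) (r : ℕ) :
    (List.replicate r (pointFn c)).foldl conv G = conv G (powFn c r) := by
  induction r with
  | zero => rw [powFn_zero, conv_convOne]; rfl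
  | succ r ih =>
    rw [List.replicate_succ', List.foldl_append, ih, List.foldl_cons, List.foldl_nil, conv_assoc,
      powFn_conv_pointFn]

end

/-- The forest with one vertex. -/
def point : FinForest where
  V := Unit
  ancestors_chain _ _ _ _ _ := Or.inl le_rfl

theorem mk_restrict_of_card_eq_one {S : Finset P.V} (h : S.card = 1) :
    RootedForest.mk (P.restrict S) = RootedForest.mk point := by
  obtain ⟨v, rfl⟩ := Finset.card_eq_one.1 h
  exact RootedForest.mk_eq_of_iso (P := P.restrict {v}) (Q := point)
    { toFun := fun _ => ()
      invFun := fun _ => ⟨v, by simp⟩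
      left_inv := fun w => Subtype.ext (Finset.mem_singleton.1 w.2).symm
      right_inv := fun _ => rfl
      map_rel_iff' := by
        rintro ⟨a, ha⟩ ⟨b, hb⟩
        rw [Finset.mem_singleton] at ha hb
        subst ha hb
        exact ⟨fun _ => le_rfl, fun _ => le_rfl⟩ }

/-- The basis element of the Connes-Kreimer algebra given by the one-vertex forest. -/
def pt : ConnesKreimer := MonoidAlgebra.single (RootedForest.mk point) 1

theorem proj_basisOn (d : ℕ) (U : Finset P.V) :
    proj d (P.basisOn U) = if U.card = d then P.basisOn U else 0 := by
  rw [proj, liftBasis_basisOn]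
  change (if (P.restrict U).degree = d then _ else _) = _
  rw [restrict_degree]
  rfl

theorem proj_one_basisOn (U : Finset P.V) : proj 1 (P.basisOn U) = pointFn pt U := by
  rw [proj_basisOn, pointFn]
  split_ifs with h
  · rw [basisOn, mk_restrict_of_card_eq_one h, pt]
  · rfl

/-- This is the hook length formula: the rescaling function is an n-fold convolution power of the
one-vertex function. -/
theorem eta_basisOn (n : ℕ) (U : Finset P.V) :
    eta n (P.basisOn U) = if U.card = n then (n.factorial : ℝ) * P.weight U else 0 := by
  rw [eta, mulComp_basisOn, List.map_replicate]
  have : (fun S : Finset P.V => (coeffSum ∘ₗ proj 1) (P.basisOn S)) = pointFn (1 : ℝ) := by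
    funext S
    rw [LinearMap.comp_apply, proj_one_basisOn, pointFn, pointFn]
    split_ifs
    · rw [coeffSum, pt, liftBasis_single, one_smul]
    · rw [map_zero]
  rw [this, foldl_conv_replicate, convOne_conv, powFn]
  simp

theorem descentOp_basisOn (r₁ r₂ r₃ : ℕ) (U : Finset P.V) :
    descentOp (List.replicate r₁ 1 ++ [r₂] ++ List.replicate r₃ 1) (P.basisOn U) =
      conv (conv (powFn pt r₁) fun S => if S.card = r₂ then P.basisOn S else 0)
        (powFn pt r₃) U := by
  rw [descentOp, mulComp_basisOn]
  simp only [List.map_append, List.map_replicate, List.map_cons, List.map_nil, proj_basisOn r₂]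
  have : (fun S : Finset P.V => proj 1 (P.basisOn S)) = pointFn pt := funext proj_one_basisOn
  rw [this, List.foldl_append, List.foldl_append, foldl_conv_replicate, foldl_conv_replicate,
    convOne_conv]
  rfl

/-- `U ↦ q ^ |U| / ∏ h(u) • pt ^ |U|`, where the product is over the vertices of `U`. -/
def expFn (q : ℝ) (U : Finset P.V) : ConnesKreimer := scaledWeight q U • pt ^ U.card

/-- The identity of the algebra, with the component of degree `d` rescaled by `q ^ d`. -/
def dilFn (q : ℝ) (U : Finset P.V) : ConnesKreimer := q ^ U.card • P.basisOn U

/-- Each decomposition of `U` into three layers occurs for exactly one triple of degrees, so summing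
over the triples removes the degree projections. -/
theorem trintober_basisOn {n : ℕ} {U : Finset P.V} (hU : U.card = n) (q₁ q₂ q₃ : ℝ) :
    trintober n q₁ q₂ q₃ (P.basisOn U) =
      conv (conv (expFn q₁) (dilFn q₂)) (expFn q₃) U := by
  unfold trintober
  simp only [LinearMap.sum_apply, LinearMap.smul_apply, descentOp_basisOn]
  unfold conv
  simp only [Finset.smul_sum, Finset.sum_mul]
  have h1 : ∀ r ∈ Finset.HasAntidiagonal.antidiagonal n,
      (∑ s ∈ Finset.HasAntidiagonal.antidiagonal r.2, ∑ B ∈ P.trunksIn U,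
        ∑ S ∈ P.trunksIn (U \ B),
        (q₁ ^ r.1 * q₂ ^ s.1 * q₃ ^ s.2 / (r.1.factorial * s.2.factorial : ℝ)) •
          (powFn pt r.1 ((U \ B) \ S) * (if S.card = s.1 then P.basisOn S else 0) *
            powFn pt s.2 B)) =
      ∑ B ∈ P.trunksIn U, ∑ S ∈ P.trunksIn (U \ B),
        if r = (((U \ B) \ S).card, S.card + B.card) then
          expFn q₁ ((U \ B) \ S) * dilFn q₂ S * expFn q₃ B else 0 := by
    intro r _
    rw [Finset.sum_comm]
    refine Finset.sum_congr rfl fun B hB => ?_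
    rw [Finset.sum_comm]
    refine Finset.sum_congr rfl fun S hS => ?_
    have h2 : ∀ s ∈ Finset.HasAntidiagonal.antidiagonal r.2,
        (q₁ ^ r.1 * q₂ ^ s.1 * q₃ ^ s.2 / (r.1.factorial * s.2.factorial : ℝ)) •
          (powFn pt r.1 ((U \ B) \ S) * (if S.card = s.1 then P.basisOn S else 0) *
            powFn pt s.2 B) =
        if s = (S.card, B.card) then
          (if r = (((U \ B) \ S).card, S.card + B.card) then
          expFn q₁ ((U \ B) \ S) * dilFn q₂ S * expFn q₃ B else 0) else 0 := by
      rintro ⟨s, t⟩ hs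
      rw [Finset.HasAntidiagonal.mem_antidiagonal] at hs
      obtain ⟨a, b⟩ := r
      simp only [Prod.mk.injEq] at hs ⊢
      unfold powFn expFn dilFn scaledWeight
      by_cases h3 : S.card = s
      · by_cases h4 : B.card = t
        · by_cases h5 : ((U \ B) \ S).card = a
          · have h6 : b = S.card + B.card := by omega
            subst h3 h4 h5
            simp only [if_true, h6, and_self, smul_mul_assoc, mul_smul_comm, smul_smul]
            congr 1
            -- The denominators r₁! and r₃! cancel the factorials in the convolution powers of the
            -- one-vertex function.
            have := Nat.factorial_ne_zero ((U \ B) \ S).card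
            have := Nat.factorial_ne_zero B.card
            field_simp
          · have : ¬ a = ((U \ B) \ S).card := fun h => h5 h.symm
            simp [h5, this]
        · have : ¬ t = B.card := fun h => h4 h.symm
          simp [h4, this]
      · have : ¬ s = S.card := fun h => h3 h.symm
        simp [h3, this]
    rw [Finset.sum_congr rfl h2, Finset.sum_ite_eq']
    by_cases h3 : r = (((U \ B) \ S).card, S.card + B.card)
    · rw [if_pos h3, if_pos]
      rw [h3, Finset.HasAntidiagonal.mem_antidiagonal]
    · rw [if_neg h3, ite_self]
  rw [Finset.sum_congr rfl h1, Finset.sum_comm]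
  refine Finset.sum_congr rfl fun B hB => ?_
  rw [Finset.sum_comm]
  refine Finset.sum_congr rfl fun S hS => ?_
  rw [Finset.sum_ite_eq', if_pos]
  rw [Finset.HasAntidiagonal.mem_antidiagonal]
  have h1 := Finset.card_sdiff_add_card_eq_card (mem_trunksIn.1 hB).1
  have h2 := Finset.card_sdiff_add_card_eq_card (mem_trunksIn.1 hS).1
  simp only
  omega

end FinForest

/-! ### Multiplicativity and composition of the operators. -/

namespace FinForest

open scoped Classical
open ConnesKreimer

variable {P : FinForest}

theorem expFn_conv_expFn (a b : ℝ) : conv (expFn a) (expFn b) = expFn (P := P) (a + b) := by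
  funext U
  unfold expFn
  rw [← scaledWeight_conv_scaledWeight, conv, conv, Finset.sum_smul]
  refine Finset.sum_congr rfl fun S hS => ?_
  rw [smul_mul_smul_comm, ← pow_add, Finset.card_sdiff_add_card_eq_card (mem_trunksIn.1 hS).1]

theorem expFn_zero : expFn 0 = convOne (P := P) ConnesKreimer := by
  funext U
  rw [expFn, scaledWeight_zero, convOne, convOne]
  by_cases h : U = ∅ <;> simp [h]

theorem mk_restrict_union {X₁ X₂ : Finset P.V} (hd : Disjoint X₁ X₂)
    (hX : ∀ a ∈ X₁, ∀ b ∈ X₂, ¬ a ≤ b ∧ ¬ b ≤ a) :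
    RootedForest.mk (P.restrict (X₁ ∪ X₂)) =
      RootedForest.mk (P.restrict X₁) * RootedForest.mk (P.restrict X₂) := by
  symm
  refine RootedForest.mk_eq_of_iso (P := (P.restrict X₁).union (P.restrict X₂))
    (Q := P.restrict (X₁ ∪ X₂))
    { toEquiv := Equiv.Finset.union X₁ X₂ hd
      map_rel_iff' := ?_ }
  rintro (⟨a, ha⟩ | ⟨a, ha⟩) (⟨b, hb⟩ | ⟨b, hb⟩)
  · exact (Sum.inl_le_inl_iff (α := (P.restrict X₁).V) (β := (P.restrict X₂).V)
      (a := ⟨a, ha⟩) (b := ⟨b, hb⟩)).symm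
  · exact iff_of_false (hX a ha b hb).1 Sum.not_inl_le_inr
  · exact iff_of_false (hX b hb a ha).2 Sum.not_inr_le_inl
  · exact (Sum.inr_le_inr_iff (α := (P.restrict X₁).V) (β := (P.restrict X₂).V)
      (a := ⟨a, ha⟩) (b := ⟨b, hb⟩)).symm

theorem expFn_union (q : ℝ) {X₁ X₂ : Finset P.V} (hd : Disjoint X₁ X₂)
    (hX : ∀ a ∈ X₁, ∀ b ∈ X₂, ¬ a ≤ b ∧ ¬ b ≤ a) :
    expFn q (X₁ ∪ X₂) = expFn q X₁ * expFn q X₂ := by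
  unfold expFn
  rw [scaledWeight_union q hd hX, Finset.card_union_of_disjoint hd, smul_mul_smul_comm, ← pow_add]

theorem dilFn_union (q : ℝ) {X₁ X₂ : Finset P.V} (hd : Disjoint X₁ X₂)
    (hX : ∀ a ∈ X₁, ∀ b ∈ X₂, ¬ a ≤ b ∧ ¬ b ≤ a) :
    dilFn q (X₁ ∪ X₂) = dilFn q X₁ * dilFn q X₂ := by
  unfold dilFn basisOn
  rw [mk_restrict_union hd hX, Finset.card_union_of_disjoint hd, smul_mul_smul_comm, ← pow_add,
    MonoidAlgebra.single_mul_single, one_mul]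

variable (P) in
/-- The operator `trintober`, applied to the forest induced on a set of vertices. -/
def trintFn (q₁ q₂ q₃ : ℝ) : Finset P.V → ConnesKreimer :=
  conv (conv (expFn q₁) (dilFn q₂)) (expFn q₃)

theorem trintFn_union (q₁ q₂ q₃ : ℝ) {U₁ U₂ : Finset P.V} (hd : Disjoint U₁ U₂)
    (hU : ∀ a ∈ U₁, ∀ b ∈ U₂, ¬ a ≤ b ∧ ¬ b ≤ a) :
    P.trintFn q₁ q₂ q₃ (U₁ ∪ U₂) = P.trintFn q₁ q₂ q₃ U₁ * P.trintFn q₁ q₂ q₃ U₂ := by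
  have hd' : ∀ X₁ ⊆ U₁, ∀ X₂ ⊆ U₂, Disjoint X₁ X₂ := fun X₁ h₁ X₂ h₂ =>
    Finset.disjoint_of_subset_left h₁ (Finset.disjoint_of_subset_right h₂ hd)
  have hU' : ∀ X₁ ⊆ U₁, ∀ X₂ ⊆ U₂, ∀ a ∈ X₁, ∀ b ∈ X₂, ¬ a ≤ b ∧ ¬ b ≤ a :=
    fun X₁ h₁ X₂ h₂ a ha b hb => hU a (h₁ ha) b (h₂ hb)
  refine conv_union hd hU (fun X₁ h₁ X₂ h₂ => ?_)
    fun X₁ h₁ X₂ h₂ => expFn_union q₃ (hd' X₁ h₁ X₂ h₂) (hU' X₁ h₁ X₂ h₂)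
  refine conv_union (hd' X₁ h₁ X₂ h₂) (hU' X₁ h₁ X₂ h₂) (fun Y₁ i₁ Y₂ i₂ => ?_)
    fun Y₁ i₁ Y₂ i₂ => ?_
  · exact expFn_union q₁ (hd' Y₁ (i₁.trans h₁) Y₂ (i₂.trans h₂))
      (hU' Y₁ (i₁.trans h₁) Y₂ (i₂.trans h₂))
  · exact dilFn_union q₂ (hd' Y₁ (i₁.trans h₁) Y₂ (i₂.trans h₂))
      (hU' Y₁ (i₁.trans h₁) Y₂ (i₂.trans h₂))

theorem single_mk (P : FinForest) :
    MonoidAlgebra.single (RootedForest.mk P) (1 : ℝ) = P.basisOn Finset.univ := by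
  rw [basisOn, mk_restrict_univ]

theorem trintober_mk (P : FinForest) (q₁ q₂ q₃ : ℝ) :
    trintober (RootedForest.mk P).degree q₁ q₂ q₃ (MonoidAlgebra.single (RootedForest.mk P) 1) =
      P.trintFn q₁ q₂ q₃ Finset.univ := by
  rw [single_mk]
  exact trintober_basisOn rfl q₁ q₂ q₃

theorem trintober_mk_restrict (U : Finset P.V) (q₁ q₂ q₃ : ℝ) :
    trintober (RootedForest.mk (P.restrict U)).degree q₁ q₂ q₃
      (MonoidAlgebra.single (RootedForest.mk (P.restrict U)) 1) = P.trintFn q₁ q₂ q₃ U :=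
  trintober_basisOn (restrict_degree U).symm q₁ q₂ q₃

end FinForest

namespace RootedForest

open scoped Classical
open ConnesKreimer FinForest

theorem degree_mul (x y : RootedForest) : (x * y).degree = x.degree + y.degree := by
  obtain ⟨P⟩ := x
  obtain ⟨Q⟩ := y
  exact Fintype.card_sum

theorem degree_one : (1 : RootedForest).degree = 0 := rfl

theorem degree_pow (x : RootedForest) (k : ℕ) : (x ^ k).degree = k * x.degree := by
  induction k with
  | zero => simp [degree_one]
  | succ k ih => rw [pow_succ, degree_mul, ih]; ring

theorem degree_point : (mk point).degree = 1 := rfl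

theorem mk_union_restrict_inl (P Q : FinForest) :
    mk ((P.union Q).restrict (Finset.univ.image (Sum.inl : P.V → (P.union Q).V))) = mk P := by
  symm
  exact mk_eq_of_iso (P := P) (Q := (P.union Q).restrict _)
    { toEquiv := Equiv.ofBijective (fun v => ⟨Sum.inl v, Finset.mem_image_of_mem _ (Finset.mem_univ v)⟩)
        ⟨fun v w h => Sum.inl_injective (congrArg Subtype.val h), by
          rintro ⟨v, hv⟩
          obtain ⟨w, _, rfl⟩ := Finset.mem_image.1 hv
          exact ⟨w, rfl⟩⟩
      map_rel_iff' := Sum.inl_le_inl_iff }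

theorem mk_union_restrict_inr (P Q : FinForest) :
    mk ((P.union Q).restrict (Finset.univ.image (Sum.inr : Q.V → (P.union Q).V))) = mk Q := by
  symm
  exact mk_eq_of_iso (P := Q) (Q := (P.union Q).restrict _)
    { toEquiv := Equiv.ofBijective (fun v => ⟨Sum.inr v, Finset.mem_image_of_mem _ (Finset.mem_univ v)⟩)
        ⟨fun v w h => Sum.inr_injective (congrArg Subtype.val h), by
          rintro ⟨v, hv⟩
          obtain ⟨w, _, rfl⟩ := Finset.mem_image.1 hv
          exact ⟨w, rfl⟩⟩
      map_rel_iff' := Sum.inr_le_inr_iff }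

/-- Both factors are realized as incomparable vertex sets of one concrete forest, where
`trintFn_union` applies. -/
theorem trintober_mul (q₁ q₂ q₃ : ℝ) (x y : RootedForest) :
    trintober (x * y).degree q₁ q₂ q₃ (MonoidAlgebra.single (x * y) 1) =
      trintober x.degree q₁ q₂ q₃ (MonoidAlgebra.single x 1) *
        trintober y.degree q₁ q₂ q₃ (MonoidAlgebra.single y 1) := by
  obtain ⟨P⟩ := x
  obtain ⟨Q⟩ := y
  change trintober (mk (P.union Q)).degree q₁ q₂ q₃ (MonoidAlgebra.single (mk (P.union Q)) 1) =
    trintober (mk P).degree q₁ q₂ q₃ (MonoidAlgebra.single (mk P) 1) *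
      trintober (mk Q).degree q₁ q₂ q₃ (MonoidAlgebra.single (mk Q) 1)
  rw [trintober_mk, ← mk_union_restrict_inl P Q, ← mk_union_restrict_inr P Q,
    trintober_mk_restrict, trintober_mk_restrict, ← trintFn_union]
  · congr 1
    refine (Finset.eq_univ_of_forall ?_).symm
    rintro (v | v)
    · exact Finset.mem_union_left _ (Finset.mem_image_of_mem _ (Finset.mem_univ v))
    · exact Finset.mem_union_right _ (Finset.mem_image_of_mem _ (Finset.mem_univ v))
  · rw [Finset.disjoint_left]
    intro v hv hv'
    obtain ⟨a, _, rfl⟩ := Finset.mem_image.1 hv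
    obtain ⟨b, _, hb⟩ := Finset.mem_image.1 hv'
    exact Sum.inr_ne_inl hb
  · intro a ha b hb
    obtain ⟨a, _, rfl⟩ := Finset.mem_image.1 ha
    obtain ⟨b, _, rfl⟩ := Finset.mem_image.1 hb
    exact ⟨Sum.not_inl_le_inr, Sum.not_inr_le_inl⟩

/-- The single vertex falls into one of the three layers, giving the coefficient q₁ + q₂ + q₃. -/
theorem trintober_point {q₁ q₂ q₃ : ℝ} (hq : q₁ + q₂ + q₃ = 1) :
    trintober (mk point).degree q₁ q₂ q₃ (MonoidAlgebra.single (mk point) 1) = pt := by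
  have h : ∀ F G : Finset point.V → ConnesKreimer,
      conv F G Finset.univ = F ∅ * G Finset.univ + F Finset.univ * G ∅ := by
    intro F G
    have : point.trunksIn Finset.univ = {∅, Finset.univ} := by
      ext B
      rw [mem_trunksIn]
      simp only [Finset.subset_univ, true_and, Finset.mem_insert, Finset.mem_singleton]
      constructor
      · intro _
        rcases B.eq_empty_or_nonempty with hB | ⟨b, hb⟩
        · exact Or.inl hB
        · right
          ext x
          have : x = b := Subsingleton.elim (α := Unit) x b
          simp [this, hb]
      · rintro (rfl | rfl) <;> simp
    unfold conv
    rw [this, Finset.sum_pair]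
    · simp [add_comm]
    · exact (Finset.univ_nonempty (α := Unit)).ne_empty.symm
  have h0 : ∀ F G : Finset point.V → ConnesKreimer, conv F G ∅ = F ∅ * G ∅ := by
    intro F G
    have : point.trunksIn ∅ = {∅} := by
      ext B
      rw [mem_trunksIn]
      simp only [Finset.subset_empty, Finset.mem_singleton]
      exact ⟨fun h => h.1, fun h => ⟨h, by simp [h]⟩⟩
    unfold conv
    rw [this]
    simp
  have hw : point.weight Finset.univ = 1 := by
    change ∏ u : Unit, _ = _
    rw [Fintype.prod_unique]
    have : point.hookIn Finset.univ () = 1 := by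
      unfold hookIn
      rw [Finset.filter_true_of_mem]
      · rfl
      · intro x _
        exact le_rfl
    exact this.symm ▸ by simp
  have he0 : ∀ q, expFn q (∅ : Finset point.V) = 1 := fun q => by
    simp [expFn, scaledWeight, weight]
  have he1 : ∀ q, expFn q (Finset.univ : Finset point.V) = q • pt := by
    intro q
    unfold expFn scaledWeight
    rw [hw]
    have : (Finset.univ : Finset point.V).card = 1 := rfl
    rw [this]
    simp
  have hd0 : ∀ q, dilFn q (∅ : Finset point.V) = 1 := by
    intro q
    have : mk (point.restrict ∅) = 1 :=
      mk_eq_of_iso (P := point.restrict ∅) (Q := FinForest.empty)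
        { toFun := fun v => absurd v.2 (by simp)
          invFun := fun v => v.elim
          left_inv := fun v => absurd v.2 (by simp)
          right_inv := fun v => v.elim
          map_rel_iff' := fun {v} => absurd v.2 (by simp) }
    rw [dilFn, basisOn, this]
    simp [MonoidAlgebra.one_def]
  have hd1 : ∀ q, dilFn q (Finset.univ : Finset point.V) = q • pt := by
    intro q
    rw [dilFn, ← single_mk, pt]
    have : (Finset.univ : Finset point.V).card = 1 := rfl
    rw [this, pow_one]
  rw [trintober_mk, trintFn, h, h, h0, he0, he0, he1, he1, hd0, hd1]
  simp only [one_mul, mul_one]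
  rw [← add_smul, ← add_smul, show q₃ + (q₂ + q₁) = 1 by linarith, one_smul]

theorem trintober_point_pow_mul {q₁ q₂ q₃ : ℝ} (hq : q₁ + q₂ + q₃ = 1) (k : ℕ)
    (x : RootedForest) :
    trintober (mk point ^ k * x).degree q₁ q₂ q₃ (MonoidAlgebra.single (mk point ^ k * x) 1) =
      pt ^ k * trintober x.degree q₁ q₂ q₃ (MonoidAlgebra.single x 1) := by
  induction k with
  | zero => simp
  | succ k ih =>
    rw [pow_succ', mul_assoc, trintober_mul, ih, trintober_point hq, pow_succ', mul_assoc]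

end RootedForest

namespace FinForest

open scoped Classical
open ConnesKreimer

variable {P : FinForest}

theorem expFn_mul_dilFn_mul_expFn (q₁ q₂ q₃ : ℝ) (A S B : Finset P.V) :
    expFn q₁ A * dilFn q₂ S * expFn q₃ B =
      (scaledWeight q₁ A * q₂ ^ S.card * scaledWeight q₃ B) •
        MonoidAlgebra.single (RootedForest.mk point ^ (A.card + B.card) *
          RootedForest.mk (P.restrict S)) (1 : ℝ) := by
  unfold expFn dilFn basisOn pt
  rw [MonoidAlgebra.single_pow, MonoidAlgebra.single_pow]
  simp only [smul_mul_assoc, mul_smul_comm, smul_smul, MonoidAlgebra.single_mul_single, one_pow,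
    mul_one]
  rw [pow_add]
  congr 1
  · ring
  · congr 1
    rw [mul_assoc, mul_assoc, mul_comm (RootedForest.mk (P.restrict S))]

/-- A linear functional of `trintFn` is a sum over the decompositions of a forest. -/
theorem map_trintFn {M : Type*} [AddCommMonoid M] [Module ℝ M] (L : ConnesKreimer →ₗ[ℝ] M)
    (q₁ q₂ q₃ : ℝ) (U : Finset P.V) :
    L (P.trintFn q₁ q₂ q₃ U) = ∑ B ∈ P.trunksIn U, ∑ S ∈ P.trunksIn (U \ B),
      (scaledWeight q₁ ((U \ B) \ S) * q₂ ^ S.card * scaledWeight q₃ B) •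
        L (MonoidAlgebra.single (RootedForest.mk point ^ (((U \ B) \ S).card + B.card) *
          RootedForest.mk (P.restrict S)) 1) := by
  unfold trintFn conv
  simp only [Finset.sum_mul, map_sum, expFn_mul_dilFn_mul_expFn, map_smul]

theorem degree_point_pow_mul {U B S : Finset P.V} (hB : B ∈ P.trunksIn U)
    (hS : S ∈ P.trunksIn (U \ B)) :
    (RootedForest.mk point ^ (((U \ B) \ S).card + B.card) *
      RootedForest.mk (P.restrict S)).degree = U.card := by
  rw [RootedForest.degree_mul, RootedForest.degree_pow, RootedForest.degree_point]
  have h0 : (RootedForest.mk (P.restrict S)).degree = S.card := restrict_degree S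
  have h1 := Finset.card_sdiff_add_card_eq_card (mem_trunksIn.1 hB).1
  have h2 := Finset.card_sdiff_add_card_eq_card (mem_trunksIn.1 hS).1
  omega

theorem proj_trintFn (q₁ q₂ q₃ : ℝ) (U : Finset P.V) :
    proj U.card (P.trintFn q₁ q₂ q₃ U) = P.trintFn q₁ q₂ q₃ U := by
  rw [map_trintFn]
  conv_rhs => rw [← LinearMap.id_apply (R := ℝ) (P.trintFn q₁ q₂ q₃ U), map_trintFn]
  refine Finset.sum_congr rfl fun B hB => Finset.sum_congr rfl fun S hS => ?_
  rw [proj, liftBasis_single, if_pos (degree_point_pow_mul hB hS), one_smul, LinearMap.id_apply]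

/-- Vertices already detached stay detached, so the second operator acts only on the middle layer.
Its outer factors are then absorbed into the first operator's by the semigroup law of `expFn`. -/
theorem trintober_trintFn {p₁ p₂ p₃ : ℝ} (hp : p₁ + p₂ + p₃ = 1) (q₁ q₂ q₃ : ℝ)
    (U : Finset P.V) :
    trintober U.card p₁ p₂ p₃ (P.trintFn q₁ q₂ q₃ U) =
      P.trintFn (q₁ + q₂ * p₁) (q₂ * p₂) (q₃ + q₂ * p₃) U := by
  have h1 : trintober U.card p₁ p₂ p₃ (P.trintFn q₁ q₂ q₃ U) =
      conv (conv (expFn q₁) fun S => q₂ ^ S.card • P.trintFn p₁ p₂ p₃ S) (expFn q₃) U := by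
    rw [map_trintFn]
    unfold conv
    refine Finset.sum_congr rfl fun B hB => ?_
    rw [Finset.sum_mul]
    refine Finset.sum_congr rfl fun S hS => ?_
    have := RootedForest.trintober_point_pow_mul hp (((U \ B) \ S).card + B.card)
      (RootedForest.mk (P.restrict S))
    rw [degree_point_pow_mul hB hS, trintober_mk_restrict] at this
    rw [this]
    unfold expFn
    simp only [smul_mul_assoc, mul_smul_comm, smul_smul]
    congr 1
    · ring
    · ring
  have h2 : (fun S => q₂ ^ S.card • P.trintFn p₁ p₂ p₃ S) =
      P.trintFn (q₂ * p₁) (q₂ * p₂) (q₂ * p₃) := by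
    funext S
    unfold trintFn conv
    rw [Finset.smul_sum]
    refine Finset.sum_congr rfl fun B hB => ?_
    rw [Finset.sum_mul, Finset.sum_mul, Finset.smul_sum]
    refine Finset.sum_congr rfl fun C hC => ?_
    have i1 := Finset.card_sdiff_add_card_eq_card (mem_trunksIn.1 hB).1
    have i2 := Finset.card_sdiff_add_card_eq_card (mem_trunksIn.1 hC).1
    rw [← i1, ← i2]
    unfold expFn dilFn scaledWeight
    simp only [smul_mul_assoc, mul_smul_comm, smul_smul, mul_pow, pow_add]
    congr 1
    ring
  rw [h1, h2]
  unfold trintFn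
  rw [← expFn_conv_expFn, add_comm q₃, ← expFn_conv_expFn]
  simp only [conv_assoc]

end FinForest

/-! ### Powers of the transition matrix. -/

namespace RootedForest

open scoped Classical
open ConnesKreimer FinForest

theorem coeff_single (x y : RootedForest) (c : ℝ) :
    (MonoidAlgebra.single x c).coeff y = if x = y then c else 0 := by
  simp [Finsupp.single_apply]

theorem proj_eq_sum (n : ℕ) (z : ConnesKreimer) :
    proj n z = ∑ y : OfDegree n, z.coeff y.1 • MonoidAlgebra.single y.1 (1 : ℝ) := by
  induction z using MonoidAlgebra.induction_linear with
  | zero => simp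
  | add z w hz hw => simp [hz, hw, add_smul, Finset.sum_add_distrib]
  | single x c =>
    rw [proj, liftBasis_single]
    simp only [coeff_single]
    by_cases h : x.degree = n
    · rw [if_pos h, Finset.sum_eq_single ⟨x, h⟩]
      · simp
      · intro y _ hy
        rw [if_neg, zero_smul]
        rintro rfl
        exact hy rfl
      · exact fun h' => absurd (Finset.mem_univ _) h'
    · rw [if_neg h, smul_zero]
      symm
      refine Finset.sum_eq_zero fun y _ => ?_
      rw [if_neg, zero_smul]
      rintro rfl
      exact h y.2

/-- A linear map applied to `trintober` can be evaluated on the forests of the same degree. -/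
theorem map_trintober {M : Type*} [AddCommMonoid M] [Module ℝ M] (L : ConnesKreimer →ₗ[ℝ] M)
    {n : ℕ} (q₁ q₂ q₃ : ℝ) (x : OfDegree n) :
    L (trintober n q₁ q₂ q₃ (MonoidAlgebra.single x.1 1)) =
      ∑ y : OfDegree n, (trintober n q₁ q₂ q₃ (MonoidAlgebra.single x.1 1)).coeff y.1 •
        L (MonoidAlgebra.single y.1 1) := by
  have h : proj n (trintober n q₁ q₂ q₃ (MonoidAlgebra.single x.1 1)) =
      trintober n q₁ q₂ q₃ (MonoidAlgebra.single x.1 1) := by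
    obtain ⟨⟨P⟩, rfl⟩ := x
    exact (trintober_mk P q₁ q₂ q₃).symm ▸ proj_trintFn q₁ q₂ q₃ Finset.univ
  conv_lhs => rw [← h, proj_eq_sum, map_sum]
  simp only [map_smul]

theorem trintober_trintober {n : ℕ} {p₁ p₂ p₃ : ℝ} (hp : p₁ + p₂ + p₃ = 1) (q₁ q₂ q₃ : ℝ)
    (x : OfDegree n) :
    trintober n p₁ p₂ p₃ (trintober n q₁ q₂ q₃ (MonoidAlgebra.single x.1 1)) =
      trintober n (q₁ + q₂ * p₁) (q₂ * p₂) (q₃ + q₂ * p₃) (MonoidAlgebra.single x.1 1) := by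
  obtain ⟨⟨P⟩, rfl⟩ := x
  have h := trintober_mk P
  refine (congrArg _ (h q₁ q₂ q₃)).trans (Eq.trans ?_ (h _ _ _).symm)
  exact trintober_trintFn hp q₁ q₂ q₃ Finset.univ

theorem trintober_zero_one_zero {n : ℕ} (x : OfDegree n) :
    trintober n 0 1 0 (MonoidAlgebra.single x.1 1) = MonoidAlgebra.single x.1 1 := by
  obtain ⟨⟨P⟩, rfl⟩ := x
  refine (trintober_mk P 0 1 0).trans (Eq.trans ?_ (single_mk P).symm)
  rw [trintFn, expFn_zero, convOne_conv, conv_convOne, dilFn, one_pow, one_smul]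

theorem eta_pos {n : ℕ} (x : OfDegree n) : 0 < eta n (MonoidAlgebra.single x.1 1) := by
  obtain ⟨⟨P⟩, rfl⟩ := x
  have h := eta_basisOn (mk P).degree (Finset.univ : Finset P.V)
  rw [← single_mk, if_pos (show Finset.univ.card = (mk P).degree from rfl)] at h
  refine h.trans_gt ?_
  have := weight_pos (P := P) Finset.univ
  positivity

theorem trintoberMatrix_zero_one_zero (n : ℕ) : trintoberMatrix n 0 1 0 = 1 := by
  ext x y
  unfold trintoberMatrix
  rw [trintober_zero_one_zero, coeff_single, Matrix.one_apply]
  by_cases h : x = y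
  · subst h
    rw [if_pos rfl, if_pos rfl, mul_one, div_self (eta_pos x).ne']
  · rw [if_neg h, if_neg (fun h' => h (Subtype.ext h')), mul_zero]

/-- The rescaling factors of the intermediate state cancel, leaving the composition law of the
operators. -/
theorem trintoberMatrix_mul (n : ℕ) {p₁ p₂ p₃ : ℝ} (hp : p₁ + p₂ + p₃ = 1) (q₁ q₂ q₃ : ℝ) :
    trintoberMatrix n q₁ q₂ q₃ * trintoberMatrix n p₁ p₂ p₃ =
      trintoberMatrix n (q₁ + q₂ * p₁) (q₂ * p₂) (q₃ + q₂ * p₃) := by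
  ext x z
  rw [Matrix.mul_apply]
  unfold trintoberMatrix
  let C : ConnesKreimer →ₗ[ℝ] ℝ :=
    { toFun := fun w => w.coeff z.1, map_add' := by simp, map_smul' := by simp }
  have h := map_trintober (C ∘ₗ trintober n p₁ p₂ p₃) q₁ q₂ q₃ x
  rw [LinearMap.comp_apply, trintober_trintober hp] at h
  change (trintober n _ _ _ _).coeff z.1 = _ at h
  rw [h, Finset.mul_sum]
  refine Finset.sum_congr rfl fun y _ => ?_
  have := (eta_pos x).ne'
  have := (eta_pos y).ne'
  change _ = _ * (_ * (trintober n p₁ p₂ p₃ _).coeff z.1)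
  field_simp

theorem trintoberMatrix_pow (n : ℕ) {q₁ q₂ q₃ a b : ℝ} (hsum : q₁ + q₂ + q₃ = 1)
    (hb : b * (q₁ + q₃) = q₁) (ha : a * (q₁ + q₃) = q₃) (hab : a + b = 1) (t : ℕ) :
    trintoberMatrix n q₁ q₂ q₃ ^ t =
      trintoberMatrix n (b * (1 - q₂ ^ t)) (q₂ ^ t) (a * (1 - q₂ ^ t)) := by
  induction t with
  | zero => simp [trintoberMatrix_zero_one_zero]
  | succ t ih =>
    rw [pow_succ', ih, trintoberMatrix_mul]
    · congr 1
      · linear_combination (-1 : ℝ) * hb + b * hsum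
      · ring
      · linear_combination (-1 : ℝ) * ha + a * hsum
    · linear_combination (1 - q₂ ^ t) * hab

end RootedForest

/-! ### Hook products and vertex sums on isomorphism classes. -/

namespace FinForest

open scoped Classical
open ConnesKreimer

variable {P : FinForest}

theorem hook_eq_card {Q : FinForest} (u : Q.V) (s : Finset P.V) (g : P.V → Q.V)
    (hg : Set.InjOn g s) (h : ∀ v, u ≤ v ↔ ∃ w ∈ s, g w = v) : Q.hook u = s.card := by
  unfold hook
  rw [← Finset.card_image_of_injOn hg]
  congr 1
  ext v
  simp [h v]

theorem anc_eq_card {Q : FinForest} (u : Q.V) (s : Finset P.V) (g : P.V → Q.V)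
    (hg : Set.InjOn g s) (h : ∀ v, v ≤ u ↔ ∃ w ∈ s, g w = v) : Q.anc u = s.card := by
  unfold anc
  rw [← Finset.card_image_of_injOn hg]
  congr 1
  ext v
  simp [h v]

theorem hook_restrict (U : Finset P.V) (u : (P.restrict U).V) :
    (P.restrict U).hook u = P.hookIn U u.1 := by
  symm
  unfold hook hookIn
  refine Finset.card_bij' (fun v hv => ⟨v, (Finset.mem_filter.1 hv).1⟩) (fun v _ => v.1) ?_ ?_ ?_ ?_
  · intro v hv
    exact Finset.mem_filter.2 ⟨Finset.mem_univ _, (Finset.mem_filter.1 hv).2⟩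
  · intro v hv
    exact Finset.mem_filter.2 ⟨v.2, (Finset.mem_filter.1 hv).2⟩
  · exact fun _ _ => rfl
  · exact fun _ _ => rfl

theorem anc_restrict (U : Finset P.V) (u : (P.restrict U).V) :
    (P.restrict U).anc u = P.ancIn U u.1 := by
  symm
  unfold anc ancIn
  refine Finset.card_bij' (fun v hv => ⟨v, (Finset.mem_filter.1 hv).1⟩) (fun v _ => v.1) ?_ ?_ ?_ ?_
  · intro v hv
    exact Finset.mem_filter.2 ⟨Finset.mem_univ _, (Finset.mem_filter.1 hv).2⟩
  · intro v hv
    exact Finset.mem_filter.2 ⟨v.2, (Finset.mem_filter.1 hv).2⟩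
  · exact fun _ _ => rfl
  · exact fun _ _ => rfl

theorem hook_union_inl (P Q : FinForest) (u : P.V) :
    (P.union Q).hook (Sum.inl u) = P.hook u := by
  refine hook_eq_card _ _ Sum.inl Sum.inl_injective.injOn ?_
  rintro (v | v)
  · simp only [Finset.mem_filter, Finset.mem_univ, true_and]
    exact ⟨fun h => ⟨v, Sum.inl_le_inl_iff.1 h, rfl⟩,
      fun ⟨w, hw, h⟩ => h ▸ Sum.inl_le_inl_iff.2 hw⟩
  · exact iff_of_false Sum.not_inl_le_inr fun ⟨w, _, h⟩ => Sum.inl_ne_inr h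

theorem hook_union_inr (P Q : FinForest) (u : Q.V) :
    (P.union Q).hook (Sum.inr u) = Q.hook u := by
  refine hook_eq_card _ _ Sum.inr Sum.inr_injective.injOn ?_
  rintro (v | v)
  · exact iff_of_false Sum.not_inr_le_inl fun ⟨w, _, h⟩ => Sum.inr_ne_inl h
  · simp only [Finset.mem_filter, Finset.mem_univ, true_and]
    exact ⟨fun h => ⟨v, Sum.inr_le_inr_iff.1 h, rfl⟩,
      fun ⟨w, hw, h⟩ => h ▸ Sum.inr_le_inr_iff.2 hw⟩

theorem anc_union_inl (P Q : FinForest) (u : P.V) :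
    (P.union Q).anc (Sum.inl u) = P.anc u := by
  refine anc_eq_card _ _ Sum.inl Sum.inl_injective.injOn ?_
  rintro (v | v)
  · simp only [Finset.mem_filter, Finset.mem_univ, true_and]
    exact ⟨fun h => ⟨v, Sum.inl_le_inl_iff.1 h, rfl⟩,
      fun ⟨w, hw, h⟩ => h ▸ Sum.inl_le_inl_iff.2 hw⟩
  · exact iff_of_false Sum.not_inr_le_inl fun ⟨w, _, h⟩ => Sum.inl_ne_inr h

theorem anc_union_inr (P Q : FinForest) (u : Q.V) :
    (P.union Q).anc (Sum.inr u) = Q.anc u := by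
  refine anc_eq_card _ _ Sum.inr Sum.inr_injective.injOn ?_
  rintro (v | v)
  · exact iff_of_false Sum.not_inl_le_inr fun ⟨w, _, h⟩ => Sum.inr_ne_inl h
  · simp only [Finset.mem_filter, Finset.mem_univ, true_and]
    exact ⟨fun h => ⟨v, Sum.inr_le_inr_iff.1 h, rfl⟩,
      fun ⟨w, hw, h⟩ => h ▸ Sum.inr_le_inr_iff.2 hw⟩

theorem hook_point (u : point.V) : point.hook u = 1 := by
  unfold hook
  rw [Finset.filter_true_of_mem]
  · rfl
  · intro x _
    exact le_rfl

end FinForest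

namespace RootedForest

open scoped Classical
open ConnesKreimer FinForest

/-- The inverse of the product of the hook sizes of a forest. -/
def hookWeight : RootedForest → ℝ :=
  Quotient.lift (fun P : FinForest => ∏ u : P.V, (P.hook u : ℝ)⁻¹) (by
    rintro P Q ⟨e⟩
    refine Fintype.prod_equiv e.toEquiv _ _ fun u => ?_
    rw [show Q.hook (e.toEquiv u) = P.hook u from hook_congr e u])

theorem hookWeight_mk (P : FinForest) : hookWeight (mk P) = ∏ u : P.V, (P.hook u : ℝ)⁻¹ := rfl

theorem hookWeight_restrict {P : FinForest} (U : Finset P.V) :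
    hookWeight (mk (P.restrict U)) = P.weight U := by
  rw [hookWeight_mk, weight]
  exact Finset.prod_bij (fun u _ => u.1) (fun u _ => u.2) (fun _ _ _ _ h => Subtype.ext h)
    (fun u hu => ⟨⟨u, hu⟩, Finset.mem_univ _, rfl⟩) fun u _ => by rw [hook_restrict]

theorem hookWeight_mul (x y : RootedForest) :
    hookWeight (x * y) = hookWeight x * hookWeight y := by
  obtain ⟨P⟩ := x
  obtain ⟨Q⟩ := y
  refine (Fintype.prod_sum_type (fun u : P.V ⊕ Q.V => ((P.union Q).hook u : ℝ)⁻¹)).trans ?_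
  refine congrArg₂ _ (Finset.prod_congr rfl fun u _ => ?_) (Finset.prod_congr rfl fun u _ => ?_)
  · rw [hook_union_inl]
  · rw [hook_union_inr]

theorem hookWeight_point_pow_mul (k : ℕ) (x : RootedForest) :
    hookWeight (mk point ^ k * x) = hookWeight x := by
  have h : hookWeight (mk point) = 1 := by
    rw [hookWeight_mk]
    exact Finset.prod_eq_one fun u _ => by rw [hook_point]; simp
  induction k with
  | zero => simp
  | succ k ih => rw [pow_succ', mul_assoc, hookWeight_mul, h, ih, one_mul]

theorem eta_single {n : ℕ} {x : RootedForest} (hx : x.degree = n) :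
    eta n (MonoidAlgebra.single x 1) = n.factorial * hookWeight x := by
  obtain ⟨P⟩ := x
  have h := eta_basisOn n (Finset.univ : Finset P.V)
  rw [if_pos (show Finset.univ.card = n from hx), ← hookWeight_restrict, mk_restrict_univ,
    ← single_mk] at h
  exact h

theorem fTilde_mk (n j : ℕ) (q₁ q₃ : ℝ) (P : FinForest) :
    fTilde n j q₁ q₃ (mk P) = ∑ u : P.V, ((P.hook u).choose (n - j) : ℝ) *
      (q₃ / (q₁ + q₃)) ^ (P.anc u - 1) * (q₁ / (q₁ + q₃)) ^ P.hook u := rfl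

theorem fTilde_mul (n j : ℕ) (q₁ q₃ : ℝ) (x y : RootedForest) :
    fTilde n j q₁ q₃ (x * y) = fTilde n j q₁ q₃ x + fTilde n j q₁ q₃ y := by
  obtain ⟨P⟩ := x
  obtain ⟨Q⟩ := y
  refine (Fintype.sum_sum_type (fun u : P.V ⊕ Q.V => (((P.union Q).hook u).choose (n - j) : ℝ) *
    (q₃ / (q₁ + q₃)) ^ ((P.union Q).anc u - 1) * (q₁ / (q₁ + q₃)) ^ (P.union Q).hook u)).trans ?_
  refine congrArg₂ _ (Finset.sum_congr rfl fun u _ => ?_) (Finset.sum_congr rfl fun u _ => ?_)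
  · rw [hook_union_inl, anc_union_inl]
  · rw [hook_union_inr, anc_union_inr]

/-- Isolated vertices have hook size 1, less than n - j, so they contribute nothing. This is why j
stops at n - 2. -/
theorem fTilde_point_pow_mul {n j : ℕ} (hj : j + 2 ≤ n) (q₁ q₃ : ℝ) (k : ℕ) (x : RootedForest) :
    fTilde n j q₁ q₃ (mk point ^ k * x) = fTilde n j q₁ q₃ x := by
  have h : fTilde n j q₁ q₃ (mk point) = 0 := by
    rw [fTilde_mk]
    refine Finset.sum_eq_zero fun u _ => ?_
    rw [hook_point, Nat.choose_eq_zero_of_lt (by omega)]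
    simp
  induction k with
  | zero => simp
  | succ k ih => rw [pow_succ', mul_assoc, fTilde_mul, h, ih, zero_add]

end RootedForest

/-! ### The one-step expectation as a sum over vertices. -/

namespace FinForest

open scoped Classical
open ConnesKreimer

variable {P : FinForest}

theorem fTilde_restrict (n j : ℕ) (q₁ q₃ : ℝ) (U : Finset P.V) :
    fTilde n j q₁ q₃ (RootedForest.mk (P.restrict U)) =
      ∑ u ∈ U, ((P.hookIn U u).choose (n - j) : ℝ) *
        (q₃ / (q₁ + q₃)) ^ (P.ancIn U u - 1) * (q₁ / (q₁ + q₃)) ^ P.hookIn U u := by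
  rw [RootedForest.fTilde_mk]
  exact Finset.sum_bij (fun u _ => u.1) (fun u _ => u.2) (fun _ _ _ _ h => Subtype.ext h)
    (fun u hu => ⟨⟨u, hu⟩, Finset.mem_univ _, rfl⟩)
    fun u _ => by rw [hook_restrict, anc_restrict]

variable (P) in
/-- The contribution of the vertex `u` to the function
`∑ u, binom(h(u), D) * a ^ (a(u) - 1) * b ^ h(u)` of the forest induced on `U`, multiplied by
`q ^ |U| / ∏ h(u)`. -/
def vertexFn (D : ℕ) (a b : ℝ) (u : P.V) (q : ℝ) (U : Finset P.V) : ℝ :=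
  scaledWeight q U * if u ∈ U then ((P.hookIn U u).choose D : ℝ) *
    a ^ (P.ancIn U u - 1) * b ^ P.hookIn U u else 0

theorem sum_trintoberMatrix_mul_fTilde {n j : ℕ} (hj : j + 2 ≤ n) (hP : P.degree = n)
    (p₁ p₂ p₃ q₁ q₃ : ℝ) :
    ∑ y : RootedForest.OfDegree n, trintoberMatrix n p₁ p₂ p₃ ⟨RootedForest.mk P, hP⟩ y *
        fTilde n j q₁ q₃ y.1 =
      (∑ u : P.V, conv (conv (scaledWeight p₁)
        (P.vertexFn (n - j) (q₃ / (q₁ + q₃)) (q₁ / (q₁ + q₃)) u p₂))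
        (scaledWeight p₃) Finset.univ) / P.weight Finset.univ := by
  subst hP
  let x : RootedForest.OfDegree P.degree := ⟨RootedForest.mk P, rfl⟩
  let L : ConnesKreimer →ₗ[ℝ] ℝ := liftBasis fun y =>
    eta P.degree (MonoidAlgebra.single y 1) * fTilde P.degree j q₁ q₃ y
  have hL : ∀ y, L (MonoidAlgebra.single y 1) =
      eta P.degree (MonoidAlgebra.single y 1) * fTilde P.degree j q₁ q₃ y := fun y => by
    rw [liftBasis_single, one_smul]
  have hx : eta P.degree (MonoidAlgebra.single x.1 1) =
      P.degree.factorial * P.weight Finset.univ := by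
    rw [RootedForest.eta_single x.2, ← RootedForest.hookWeight_restrict, mk_restrict_univ]
  have h1 : ∑ y : RootedForest.OfDegree P.degree, trintoberMatrix P.degree p₁ p₂ p₃ x y *
      fTilde P.degree j q₁ q₃ y.1 =
      L (trintober P.degree p₁ p₂ p₃ (MonoidAlgebra.single x.1 1)) /
        eta P.degree (MonoidAlgebra.single x.1 1) := by
    rw [RootedForest.map_trintober, Finset.sum_div]
    refine Finset.sum_congr rfl fun y _ => ?_
    rw [hL, trintoberMatrix, smul_eq_mul]
    ring
  have h2 : L (trintober P.degree p₁ p₂ p₃ (MonoidAlgebra.single x.1 1)) =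
      P.degree.factorial * ∑ u : P.V, conv (conv (scaledWeight p₁)
        (P.vertexFn (P.degree - j) (q₃ / (q₁ + q₃)) (q₁ / (q₁ + q₃)) u p₂))
        (scaledWeight p₃) Finset.univ := by
    refine (congrArg L (trintober_mk P p₁ p₂ p₃)).trans ?_
    rw [map_trintFn, Finset.mul_sum]
    simp only [conv, Finset.sum_mul, Finset.mul_sum]
    rw [Finset.sum_comm]
    refine Finset.sum_congr rfl fun B hB => ?_
    rw [Finset.sum_comm]
    refine Finset.sum_congr rfl fun S hS => ?_
    -- The detached vertices change neither the hook product nor the vertex sum, so only the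
    -- surviving layer `S` matters.
    rw [hL, RootedForest.eta_single (n := P.degree) (degree_point_pow_mul hB hS),
      RootedForest.fTilde_point_pow_mul hj, RootedForest.hookWeight_point_pow_mul,
      RootedForest.hookWeight_restrict, fTilde_restrict]
    simp only [vertexFn, scaledWeight]
    rw [← Finset.mul_sum, ← Finset.sum_mul, ← Finset.mul_sum, ← Finset.mul_sum,
      Finset.sum_ite_mem, Finset.univ_inter, smul_eq_mul]
    simp only [degree]
    ring
  refine h1.trans ?_
  rw [h2, hx, mul_div_mul_left]
  exact_mod_cast P.degree.factorial_ne_zero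

end FinForest

/-! ### Comparison of the vertex contributions with explicit bounds. -/

namespace FinForest

open scoped Classical

variable {P : FinForest}

theorem eq_of_root_le_root {U : Finset P.V} {r s u : P.V} (hr : r ∈ P.rootsIn U)
    (hs : s ∈ P.rootsIn U) (hru : r ≤ u) (hsu : s ≤ u) : r = s :=
  (mem_rootsIn.1 hs).2 r (mem_rootsIn.1 hr).1 (root_le_of_le hr (mem_rootsIn.1 hs).1 hru hsu)

theorem ancIn_erase_of_not_le {U : Finset P.V} {r u : P.V} (h : ¬ r ≤ u) :
    P.ancIn (U.erase r) u = P.ancIn U u := by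
  unfold ancIn
  congr 1
  ext v
  simp only [Finset.mem_filter, Finset.mem_erase]
  exact ⟨fun h => ⟨h.1.2, h.2⟩, fun h' => ⟨⟨fun hv => h (hv ▸ h'.2), h'.1⟩, h'.2⟩⟩

theorem ancIn_erase_add_one {U : Finset P.V} {r u : P.V} (hr : r ∈ U) (h : r ≤ u) :
    P.ancIn (U.erase r) u + 1 = P.ancIn U u := by
  unfold ancIn
  rw [Finset.filter_erase]
  exact Finset.card_erase_add_one (Finset.mem_filter.2 ⟨hr, h⟩)

theorem ancIn_root {U : Finset P.V} {u : P.V} (hu : u ∈ P.rootsIn U) : P.ancIn U u = 1 := by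
  unfold ancIn
  rw [Finset.card_eq_one]
  refine ⟨u, ?_⟩
  ext v
  rw [Finset.mem_filter, Finset.mem_singleton]
  exact ⟨fun h => (mem_rootsIn.1 hu).2 v h.1 h.2,
    fun h => ⟨h.symm ▸ (mem_rootsIn.1 hu).1, h.le⟩⟩

theorem hookIn_le_card (U : Finset P.V) (u : P.V) : P.hookIn U u ≤ U.card :=
  Finset.card_filter_le _ _

theorem hookIn_lt_hookIn {U : Finset P.V} {r s : P.V} (hr : r ∈ U) (h : r < s) :
    P.hookIn U s < P.hookIn U r := by
  refine Finset.card_lt_card ⟨fun v hv => ?_, fun hsub => ?_⟩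
  · rw [Finset.mem_filter] at hv ⊢
    exact ⟨hv.1, h.le.trans hv.2⟩
  · have := hsub (Finset.mem_filter.2 ⟨hr, le_rfl⟩)
    exact absurd (Finset.mem_filter.1 this).2 h.not_ge

theorem mem_rootsIn_erase {U : Finset P.V} {r s : P.V} (hr : r ∈ P.rootsIn U) (hne : r ≠ s) :
    r ∈ P.rootsIn (U.erase s) := by
  rw [mem_rootsIn] at hr ⊢
  exact ⟨Finset.mem_erase.2 ⟨hne, hr.1⟩, fun a ha => hr.2 a (Finset.mem_of_mem_erase ha)⟩

variable (P) in
/-- The function bounding the contribution of the vertex `u`, whose root is `r`. -/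
def boundFn (N : ℕ → ℝ) (c l : ℝ) (u : P.V) (τ : ℝ) (U : Finset P.V) (r : P.V) : ℝ :=
  P.weight U * N (P.hookIn U u) * (P.hookIn U r).choose (P.ancIn U u - 1) *
    ((c + τ) ^ (P.ancIn U u - 1) * (l + τ) ^ (U.card - P.hookIn U r))

theorem boundFn_nonneg {N : ℕ → ℝ} {c l τ : ℝ} (hN : ∀ h, 0 ≤ N h) (hc : 0 ≤ c) (hl : 0 ≤ l)
    (hτ : 0 ≤ τ) (u : P.V) (U : Finset P.V) (r : P.V) : 0 ≤ P.boundFn N c l u τ U r := by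
  have := weight_nonneg U
  have := hN (P.hookIn U u)
  unfold boundFn
  positivity

/-- If f evolves by root removal, strong induction on the size of `U` bounds its derivative by that
of `boundFn`. Of the two summands of the latter, one pays for removing the root above u and the
other for removing the remaining roots. The alternative in `hU` lets a set be handled by a direct
bound where the evolution equation fails. -/
theorem le_boundFn {f : ℝ → Finset P.V → ℝ} {u : P.V} {T c l : ℝ} {N : ℕ → ℝ}
    (hN : ∀ h, 0 ≤ N h) (hc : 0 ≤ c) (hl : 0 ≤ l) (hlT : l + T ≤ 1)
    (hf : ∀ τ U, u ∉ U → f τ U = 0)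
    (hU : ∀ U, u ∈ U → ∀ r ∈ P.rootsIn U, r ≤ u →
      ((∀ τ, HasDerivAt (fun τ => f τ U) (∑ s ∈ P.rootsIn U, f τ (U.erase s)) τ) ∧
        f 0 U ≤ P.boundFn N c l u 0 U r) ∨
      ∀ τ ∈ Set.Icc 0 T, f τ U ≤ P.boundFn N c l u τ U r) :
    ∀ U, u ∈ U → ∀ r ∈ P.rootsIn U, r ≤ u → ∀ τ ∈ Set.Icc 0 T,
      f τ U ≤ P.boundFn N c l u τ U r := by
  intro U
  induction hn : U.card using Nat.strong_induction_on generalizing U with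
  | _ n ih =>
  intro hu r hr hru τ hτ
  rcases hU U hu r hr hru with ⟨hd, h0⟩ | h
  swap
  · exact h τ hτ
  have hrU := (mem_rootsIn.1 hr).1
  have hB : ∀ τ, HasDerivAt (fun τ => P.boundFn N c l u τ U r)
      (P.weight U * N (P.hookIn U u) * (P.hookIn U r).choose (P.ancIn U u - 1) *
        ((P.ancIn U u - 1 : ℕ) * (c + τ) ^ (P.ancIn U u - 1 - 1) *
          (l + τ) ^ (U.card - P.hookIn U r) +
        (c + τ) ^ (P.ancIn U u - 1) * ((U.card - P.hookIn U r : ℕ) *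
          (l + τ) ^ (U.card - P.hookIn U r - 1)))) τ := by
    intro τ
    have h1 := (((hasDerivAt_id' τ).const_add c).fun_pow (P.ancIn U u - 1))
    have h2 := (((hasDerivAt_id' τ).const_add l).fun_pow (U.card - P.hookIn U r))
    have h3 := (h1.fun_mul h2).const_mul
      (P.weight U * N (P.hookIn U u) * (P.hookIn U r).choose (P.ancIn U u - 1))
    simp only [mul_one] at h3
    exact h3
  refine image_le_of_deriv_right_le_deriv_boundary
    (fun x _ => (hd x).continuousAt.continuousWithinAt) (fun x _ => (hd x).hasDerivWithinAt) h0
    (fun x _ => (hB x).continuousAt.continuousWithinAt) (fun x _ => (hB x).hasDerivWithinAt)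
    ?_ hτ
  intro x hx
  have hx' : x ∈ Set.Icc 0 T := Set.Ico_subset_Icc_self hx
  have hx0 : 0 ≤ x := hx.1
  have hcard : ∀ s ∈ P.rootsIn U, (U.erase s).card + 1 = n := fun s hs => by
    rw [Finset.card_erase_add_one (mem_rootsIn.1 hs).1, hn]
  have hHn : P.hookIn U r ≤ n := hn ▸ hookIn_le_card U r
  have hW := weight_nonneg U
  have hNh := hN (P.hookIn U u)
  rw [← Finset.add_sum_erase _ _ hr, mul_add]
  refine add_le_add ?_ ?_
  · by_cases hur : r = u
    · rw [hf x _ (by rw [hur]; exact Finset.notMem_erase u U)]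
      have : 0 ≤ l + x := by positivity
      have : 0 ≤ c + x := by positivity
      positivity
    · have hu' : u ∈ U.erase r := Finset.mem_erase.2 ⟨fun h => hur h.symm, hu⟩
      obtain ⟨s, hs, hsu⟩ := exists_root_le hu'
      have hsU := Finset.mem_erase.1 (mem_rootsIn.1 hs).1
      -- Once r is removed, the root above u is a proper descendant s of r, with a strictly smaller
      -- hook.
      have hrs : r < s := lt_of_le_of_ne (root_le_of_le hr hsU.2 hru hsu) fun h => hsU.1 h.symm
      have h1 := ih _ (by have := hcard r hr; omega) (U.erase r) rfl hu' s hs hsu x hx'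
      refine h1.trans ?_
      have h2 := hookIn_lt_hookIn hrU hrs
      have h3 := ancIn_erase_add_one hrU hru
      have h4 := ancIn_pos hu'
      have h5 := hcard r hr
      rw [boundFn, weight_erase hr, hookIn_erase hr hu fun h => hur h.symm,
        hookIn_erase hr hsU.2 hsU.1]
      obtain ⟨k, hk⟩ := Nat.exists_eq_succ_of_ne_zero h4.ne'
      obtain ⟨H, hH⟩ := Nat.exists_eq_succ_of_ne_zero (hookIn_pos hrU).ne'
      have h6 : P.ancIn U u - 1 = k + 1 := by omega
      have h7 : P.ancIn (U.erase r) u - 1 = k := by omega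
      rw [h6, h7, hH, Nat.succ_eq_add_one, Nat.add_sub_cancel]
      have h8 : ((P.hookIn U s).choose k : ℝ) ≤ H.choose k := by
        exact_mod_cast Nat.choose_le_choose k (by omega)
      have h9 : (l + x) ^ ((U.erase r).card - P.hookIn U s) ≤ (l + x) ^ (U.card - (H + 1)) :=
        -- Passing from r to s can only increase the number of vertices outside the root's hook; the
        -- base is at most 1 because l + T ≤ 1.
        pow_le_pow_of_le_one (by positivity) (by linarith [hx'.2]) (by omega)
      -- The factor H + 1 from `weight_erase` is exchanged for the k + 1 from differentiating a (k +
      -- 1)-st power; this dictates the binomial coefficient in `boundFn`.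
      have h10 : ((H + 1 : ℕ) : ℝ) * H.choose k = (H + 1).choose (k + 1) * ((k + 1 : ℕ) : ℝ) := by
        exact_mod_cast Nat.add_one_mul_choose_eq H k
      have hlx : 0 ≤ l + x := by positivity
      have hcx : 0 ≤ c + x := by positivity
      calc ((H + 1 : ℕ) : ℝ) * P.weight U * N (P.hookIn U u) * (P.hookIn U s).choose k *
            ((c + x) ^ k * (l + x) ^ ((U.erase r).card - P.hookIn U s))
          ≤ ((H + 1 : ℕ) : ℝ) * P.weight U * N (P.hookIn U u) * H.choose k *
            ((c + x) ^ k * (l + x) ^ (U.card - (H + 1))) := by gcongr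
        _ = _ := by
          linear_combination (P.weight U * N (P.hookIn U u) *
            ((c + x) ^ k * (l + x) ^ (U.card - (H + 1)))) * h10
  · have h1 : ∀ s ∈ (P.rootsIn U).erase r, f x (U.erase s) ≤
        P.hookIn U s * (P.weight U * N (P.hookIn U u) *
          (P.hookIn U r).choose (P.ancIn U u - 1) *
          ((c + x) ^ (P.ancIn U u - 1) * (l + x) ^ (U.card - P.hookIn U r - 1))) := by
      intro s hs
      obtain ⟨hsr, hs⟩ := Finset.mem_erase.1 hs
      have hsu : ¬ s ≤ u := fun h => hsr (eq_of_root_le_root hs hr h hru)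
      have hus : u ≠ s := fun h => hsu h.ge
      have h5 := hcard s hs
      refine (ih _ (by omega) (U.erase s) rfl (Finset.mem_erase.2 ⟨hus, hu⟩) r
        (mem_rootsIn_erase hr hsr.symm) hru x hx').trans (le_of_eq ?_)
      rw [boundFn, weight_erase hs, hookIn_erase hs hu hus, hookIn_erase hs hrU hsr.symm,
        ancIn_erase_of_not_le hsu,
        show (U.erase s).card - P.hookIn U r = U.card - P.hookIn U r - 1 by omega]
      ring
    refine (Finset.sum_le_sum h1).trans (le_of_eq ?_)
    -- The other roots' hooks cover the complement of the hook of r, matching the exponent brought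
    -- down from (l + τ).
    have h2 : ∑ s ∈ (P.rootsIn U).erase r, (P.hookIn U s : ℝ) =
        ((U.card - P.hookIn U r : ℕ) : ℝ) := by
      have := Finset.add_sum_erase _ (P.hookIn U) hr
      rw [sum_hookIn_roots] at this
      rw [← Nat.cast_sum]
      congr 1
      omega
    rw [← Finset.sum_mul, h2]
    ring

theorem sum_choose_mul_choose (h D : ℕ) (X Y : ℝ) :
    ∑ m ∈ Finset.range (h + 1), X ^ m * Y ^ (h - m) * h.choose m * m.choose D =
      h.choose D * X ^ D * (X + Y) ^ (h - D) := by
  rcases lt_or_ge h D with hD | hD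
  · rw [Nat.choose_eq_zero_of_lt hD]
    simp only [Nat.cast_zero, zero_mul]
    refine Finset.sum_eq_zero fun m hm => ?_
    rw [Nat.choose_eq_zero_of_lt (by rw [Finset.mem_range] at hm; omega : m < D)]
    simp
  · obtain ⟨e, rfl⟩ := Nat.exists_eq_add_of_le hD
    rw [add_assoc, Finset.sum_range_add, Finset.sum_eq_zero, zero_add, Nat.add_sub_cancel_left,
      add_pow, Finset.mul_sum]
    · refine Finset.sum_congr rfl fun i hi => ?_
      rw [Finset.mem_range] at hi
      have h1 := Nat.choose_mul (n := D + e) (show D ≤ D + i by omega)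
      rw [Nat.add_sub_cancel_left, Nat.add_sub_cancel_left] at h1
      have h2 : ((D + e).choose (D + i) : ℝ) * (D + i).choose D =
          (D + e).choose D * e.choose i := by exact_mod_cast h1
      rw [show D + e - (D + i) = e - i by omega, pow_add]
      linear_combination X ^ D * X ^ i * Y ^ (e - i) * h2
    · intro m hm
      rw [Finset.mem_range] at hm
      rw [Nat.choose_eq_zero_of_lt hm]
      simp

theorem vertexFn_eq_pow_mul (D : ℕ) (a b : ℝ) (u : P.V) (q : ℝ) (U : Finset P.V) :
    P.vertexFn D a b u q U = a ^ (P.ancIn U u - 1) * P.vertexFn D 1 b u q U := by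
  unfold vertexFn
  split_ifs
  · rw [one_pow]
    ring
  · simp

theorem vertexFn_of_notMem (D : ℕ) (a b : ℝ) {u : P.V} (q : ℝ) {U : Finset P.V} (hu : u ∉ U) :
    P.vertexFn D a b u q U = 0 := by
  rw [vertexFn, if_neg hu, mul_zero]

theorem conv_vertexFn_of_notMem (F : Finset P.V → ℝ) (D : ℕ) (a b : ℝ) {u : P.V} (q : ℝ)
    {U : Finset P.V} (hu : u ∉ U) : conv F (P.vertexFn D a b u q) U = 0 :=
  Finset.sum_eq_zero fun S hS => by
    rw [vertexFn_of_notMem D a b q fun h => hu ((mem_trunksIn.1 hS).1 h), mul_zero]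

theorem ancIn_trunk {U S : Finset P.V} {u : P.V} (hS : S ∈ P.trunksIn U) (hu : u ∈ S) :
    P.ancIn S u = P.ancIn U u := by
  rw [mem_trunksIn] at hS
  unfold ancIn
  congr 1
  ext v
  simp only [Finset.mem_filter]
  exact ⟨fun h => ⟨hS.1 h.1, h.2⟩, fun h => ⟨hS.2 u hu v h.1 h.2, h.2⟩⟩

/-- Trunks keep all ancestors of u, so the power of a is constant in the sum. Factoring it out
matters because root removal changes the number of ancestors. -/
theorem conv_vertexFn_eq_pow_mul (F : Finset P.V → ℝ) (D : ℕ) (a b : ℝ) (u : P.V) (q : ℝ)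
    (U : Finset P.V) : conv F (P.vertexFn D a b u q) U =
      a ^ (P.ancIn U u - 1) * conv F (P.vertexFn D 1 b u q) U := by
  unfold conv
  rw [Finset.mul_sum]
  refine Finset.sum_congr rfl fun S hS => ?_
  by_cases hu : u ∈ S
  · rw [vertexFn_eq_pow_mul, ancIn_trunk hS hu]
    ring
  · rw [vertexFn_of_notMem D a b q hu, vertexFn_of_notMem D 1 b q hu]
    simp

/-- Removing a root other than u preserves the hook of u. For u itself a root the equation may fail,
since removing u kills the term. -/
theorem hasDerivAt_vertexFn (D : ℕ) (b : ℝ) {u : P.V} (q : ℝ) {S : Finset P.V}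
    (hu : u ∉ P.rootsIn S) :
    HasDerivAt (fun q => P.vertexFn D 1 b u q S)
      (conv (P.vertexFn D 1 b u q) (pointFn 1) S) q := by
  by_cases huS : u ∈ S
  · have h : conv (P.vertexFn D 1 b u q) (pointFn 1) S =
        conv (scaledWeight q) (pointFn 1) S *
          (((P.hookIn S u).choose D : ℝ) * 1 ^ (P.ancIn S u - 1) * b ^ P.hookIn S u) := by
      rw [conv_pointFn, conv_pointFn, Finset.sum_mul]
      refine Finset.sum_congr rfl fun r hr => ?_
      have hur : u ≠ r := fun h => hu (h ▸ hr)
      rw [vertexFn, if_pos (Finset.mem_erase.2 ⟨hur, huS⟩), hookIn_erase hr huS hur]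
      simp only [one_pow, mul_one]
    rw [h]
    simp only [vertexFn, if_pos huS]
    exact (hasDerivAt_scaledWeight q S).mul_const _
  · have h : conv (P.vertexFn D 1 b u q) (pointFn 1) S = 0 := by
      rw [conv_pointFn]
      refine Finset.sum_eq_zero fun r _ => ?_
      rw [vertexFn_of_notMem, zero_mul]
      exact fun h => huS (Finset.mem_of_mem_erase h)
    rw [h]
    simp only [vertexFn, if_neg huS, mul_zero]
    exact hasDerivAt_const _ _

/-- The exact contribution of a root. -/
theorem conv_vertexFn_root {D : ℕ} (hD : 0 < D) (b p q : ℝ) {u : P.V} {U : Finset P.V}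
    (hu : u ∈ P.rootsIn U) :
    conv (scaledWeight p) (P.vertexFn D 1 b u q) U =
      P.weight U * ((P.hookIn U u).choose D * (b * q) ^ D * (b * q + p) ^ (P.hookIn U u - D)) *
        (p + q) ^ (U.card - P.hookIn U u) := by
  have huU := (mem_rootsIn.1 hu).1
  set U₁ := U.filter fun v => u ≤ v with hU₁
  set U₂ := U.filter fun v => ¬ u ≤ v with hU₂
  have hun : U = U₁ ∪ U₂ := (Finset.filter_union_filter_not_eq _ _).symm
  have hd : Disjoint U₁ U₂ := Finset.disjoint_filter_filter_not _ _ _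
  have hrel : ∀ a ∈ U₁, ∀ b ∈ U₂, ¬ a ≤ b ∧ ¬ b ≤ a := by
    intro a ha b hb
    rw [Finset.mem_filter] at ha hb
    refine ⟨fun h => hb.2 (ha.2.trans h), fun h => ?_⟩
    exact hb.2 (root_le_of_le hu hb.1 ha.2 h)
  have hd' : ∀ X₁ ⊆ U₁, ∀ X₂ ⊆ U₂, Disjoint X₁ X₂ := fun X₁ h₁ X₂ h₂ =>
    Finset.disjoint_of_subset_left h₁ (Finset.disjoint_of_subset_right h₂ hd)
  have hrel' : ∀ X₁ ⊆ U₁, ∀ X₂ ⊆ U₂, ∀ a ∈ X₁, ∀ b ∈ X₂, ¬ a ≤ b ∧ ¬ b ≤ a :=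
    fun X₁ h₁ X₂ h₂ a ha b hb => hrel a (h₁ ha) b (h₂ hb)
  have hc : U₁.card = P.hookIn U u := rfl
  have hc2 : U₂.card = U.card - P.hookIn U u := by
    have := Finset.card_union_of_disjoint hd
    rw [← hun] at this
    omega
  -- The hook of a root is incomparable with the rest, so the convolution factors; the second factor
  -- is a semigroup product.
  have h1 : conv (scaledWeight p) (P.vertexFn D 1 b u q) (U₁ ∪ U₂) =
      conv (scaledWeight p) (P.vertexFn D 1 b u q) U₁ *
        conv (scaledWeight p) (scaledWeight q) U₂ := by
    refine conv_union hd hrel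
      (fun X₁ h₁ X₂ h₂ => scaledWeight_union p (hd' X₁ h₁ X₂ h₂) (hrel' X₁ h₁ X₂ h₂))
      fun X₁ h₁ X₂ h₂ => ?_
    have hX₂ : ∀ v ∈ X₂, ¬ u ≤ v := fun v hv => (Finset.mem_filter.1 (h₂ hv)).2
    have hmem : u ∈ X₁ ∪ X₂ ↔ u ∈ X₁ := by
      rw [Finset.mem_union, or_iff_left fun h => hX₂ u h le_rfl]
    have hhook : P.hookIn (X₁ ∪ X₂) u = P.hookIn X₁ u := by
      unfold hookIn
      rw [Finset.filter_union, Finset.filter_false_of_mem hX₂, Finset.union_empty]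
    unfold vertexFn
    rw [scaledWeight_union q (hd' X₁ h₁ X₂ h₂) (hrel' X₁ h₁ X₂ h₂), hhook]
    simp only [hmem, one_pow, mul_one]
    ring
  have h2 : conv (scaledWeight p) (P.vertexFn D 1 b u q) U₁ =
      conv (scaledWeight p) (fun S => scaledWeight q S * ((S.card.choose D : ℝ) * b ^ S.card))
        U₁ := by
    unfold conv
    refine Finset.sum_congr rfl fun S hS => ?_
    rw [mem_trunksIn] at hS
    congr 1
    unfold vertexFn
    congr 1
    split_ifs with huS
    · have : P.hookIn S u = S.card := by
        unfold hookIn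
        rw [Finset.filter_true_of_mem fun v hv => (Finset.mem_filter.1 (hS.1 hv)).2]
      rw [this, one_pow, mul_one]
    -- A trunk of the hook omitting u is empty, and D > 0 makes its binomial coefficient vanish too.
    · have : S = ∅ := by
        rw [Finset.eq_empty_iff_forall_notMem]
        intro v hv
        exact huS (hS.2 v hv u (Finset.mem_filter.2 ⟨huU, le_rfl⟩)
          (Finset.mem_filter.1 (hS.1 hv)).2)
      rw [this, Finset.card_empty, Nat.choose_eq_zero_of_lt hD]
      simp
  have h3 := sum_choose_mul_choose U₁.card D (b * q) p
  have h4 : conv (scaledWeight p) (P.vertexFn D 1 b u q) U =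
      conv (scaledWeight p) (P.vertexFn D 1 b u q) (U₁ ∪ U₂) := congrArg _ hun
  rw [h4, h1, h2, conv_scaledWeight_mul_card (fun m => (m.choose D : ℝ) * b ^ m) p q,
    scaledWeight_conv_scaledWeight, scaledWeight, hc2,
    show P.weight U = P.weight U₁ * P.weight U₂ by rw [← weight_union hd hrel, ← hun], ← hc, ← h3]
  rw [show ∑ m ∈ Finset.range (U₁.card + 1), q ^ m * p ^ (U₁.card - m) * U₁.card.choose m *
      ((m.choose D : ℝ) * b ^ m) = ∑ m ∈ Finset.range (U₁.card + 1),
      (b * q) ^ m * p ^ (U₁.card - m) * U₁.card.choose m * m.choose D from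
    Finset.sum_congr rfl fun m _ => by rw [mul_pow]; ring]
  ring

/-- First comparison, with the surviving parameter x running from 0 to q. The root factor N is
frozen at its value for q, which dominates every x ≤ q. -/
theorem conv_vertexFn_le {D : ℕ} (hD : 0 < D) {b p q : ℝ} (hb : 0 ≤ b) (hp : 0 ≤ p) (hq : 0 ≤ q)
    (hpq : p + q ≤ 1) {u : P.V} {U : Finset P.V} (hu : u ∈ U) {r : P.V} (hr : r ∈ P.rootsIn U)
    (hru : r ≤ u) :
    conv (scaledWeight p) (P.vertexFn D 1 b u q) U ≤
      P.boundFn (fun h => h.choose D * (b * q) ^ D * (b * q + p) ^ (h - D)) 0 p u q U r := by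
  have hN : ∀ h : ℕ, (0 : ℝ) ≤ h.choose D * (b * q) ^ D * (b * q + p) ^ (h - D) := fun h => by
    positivity
  refine le_boundFn (f := fun x => conv (scaledWeight p) (P.vertexFn D 1 b u x)) hN le_rfl hp hpq
    (fun x U h => conv_vertexFn_of_notMem _ D 1 b x h) ?_ U hu r hr hru q ⟨hq, le_rfl⟩
  clear hu hr hru r U
  intro U hu r hr hru
  by_cases hroot : u ∈ P.rootsIn U
  · right
    rintro x ⟨hx0, hxq⟩
    obtain rfl := eq_of_root_le_root hr hroot hru le_rfl
    rw [conv_vertexFn_root hD b p x hroot, boundFn, ancIn_root hroot]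
    simp only [Nat.sub_self, Nat.choose_zero_right, Nat.cast_one, mul_one, pow_zero, one_mul]
    have := weight_nonneg U
    gcongr
  · left
    constructor
    · intro x
      refine hasDerivAt_conv fun S hS => hasDerivAt_vertexFn D b x fun h => hroot ?_
      rw [mem_rootsIn] at h ⊢
      rw [mem_trunksIn] at hS
      exact ⟨hu, fun a ha hau => h.2 a (hS.2 u h.1 a ha hau) hau⟩
    -- At parameter 0 only the empty set survives, and it does not contain u.
    · have h0 : conv (scaledWeight p) (P.vertexFn D 1 b u 0) U = 0 := by
        refine Finset.sum_eq_zero fun S _ => ?_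
        by_cases huS : u ∈ S
        · have : S ≠ ∅ := Finset.ne_empty_of_mem huS
          rw [vertexFn, scaledWeight_zero, convOne, if_neg this, zero_mul, mul_zero]
        · rw [vertexFn_of_notMem D 1 b 0 huS, mul_zero]
      rw [h0]
      exact boundFn_nonneg hN le_rfl hp le_rfl u U r

/-- Second comparison, in the parameter of the layer removed at the roots. Its initial value is the
first bound times a power of a, whence c = a p₂ and l = p₁ + p₂. -/
theorem conv_conv_vertexFn_le {D : ℕ} (hD : 0 < D) {a b p₁ p₂ p₃ : ℝ} (ha : 0 ≤ a) (hb : 0 ≤ b)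
    (hp₁ : 0 ≤ p₁) (hp₂ : 0 ≤ p₂) (hp₃ : 0 ≤ p₃) (hp : p₁ + p₂ + p₃ ≤ 1) {u : P.V}
    {U : Finset P.V} (hu : u ∈ U) {r : P.V} (hr : r ∈ P.rootsIn U) (hru : r ≤ u) :
    conv (conv (scaledWeight p₁) (P.vertexFn D a b u p₂)) (scaledWeight p₃) U ≤
      P.boundFn (fun h => h.choose D * (b * p₂) ^ D * (b * p₂ + p₁) ^ (h - D))
        (a * p₂) (p₁ + p₂) u p₃ U r := by
  have hN : ∀ h : ℕ, (0 : ℝ) ≤ h.choose D * (b * p₂) ^ D * (b * p₂ + p₁) ^ (h - D) := fun h => by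
    positivity
  refine le_boundFn (f := fun x => conv (conv (scaledWeight p₁) (P.vertexFn D a b u p₂))
    (scaledWeight x)) hN (by positivity) (by positivity) hp ?_ ?_ U hu r hr hru p₃ ⟨hp₃, le_rfl⟩
  · intro x U h
    refine Finset.sum_eq_zero fun S _ => ?_
    rw [conv_vertexFn_of_notMem, zero_mul]
    exact fun h' => h (Finset.mem_sdiff.1 h').1
  · clear hu hr hru r U
    intro U hu r hr hru
    left
    refine ⟨fun x => hasDerivAt_conv fun S _ => hasDerivAt_scaledWeight x S, ?_⟩
    rw [scaledWeight_zero, conv_convOne, conv_vertexFn_eq_pow_mul]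
    refine (mul_le_mul_of_nonneg_left (conv_vertexFn_le hD hb hp₁ hp₂ (by linarith) hu hr hru)
      (by positivity)).trans (le_of_eq ?_)
    unfold boundFn
    rw [add_zero, add_zero, zero_add, mul_pow]
    ring

theorem conv_conv_vertexFn_le_choose {D : ℕ} (hD : 0 < D) {a b s : ℝ} (ha : 0 ≤ a) (hb : 0 ≤ b)
    (hab : a + b = 1) (hs : 0 ≤ s) (hs1 : s ≤ 1) {u : P.V} {U : Finset P.V} (hu : u ∈ U) :
    conv (conv (scaledWeight (b * (1 - s))) (P.vertexFn D a b u s))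
        (scaledWeight (a * (1 - s))) U ≤
      P.weight U * (s ^ D * ((P.hookIn U u).choose D * a ^ (P.ancIn U u - 1) *
        b ^ P.hookIn U u) * U.card.choose (P.ancIn U u - 1)) := by
  obtain ⟨r, hr, hru⟩ := exists_root_le hu
  have hs' : 0 ≤ 1 - s := by linarith
  refine (conv_conv_vertexFn_le hD ha hb (by positivity) hs (by positivity)
    (by linear_combination (1 - s) * hab) hu hr hru).trans ?_
  unfold boundFn
  -- For these parameters the three bases become a, b and 1, so s survives only in (b s)^D.
  rw [show a * s + a * (1 - s) = a by ring, show b * s + b * (1 - s) = b by ring,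
    show b * (1 - s) + s + a * (1 - s) = 1 by linear_combination (1 - s) * hab, one_pow, mul_one]
  have h1 : ((P.hookIn U u).choose D : ℝ) * (b * s) ^ D * b ^ (P.hookIn U u - D) =
      s ^ D * ((P.hookIn U u).choose D * b ^ P.hookIn U u) := by
    rcases lt_or_ge (P.hookIn U u) D with h | h
    · rw [Nat.choose_eq_zero_of_lt h]
      simp
    · conv_rhs => rw [← Nat.add_sub_cancel' h, pow_add]
      rw [Nat.add_sub_cancel' h, mul_pow]
      ring
  have h2 : ((P.hookIn U r).choose (P.ancIn U u - 1) : ℝ) ≤ U.card.choose (P.ancIn U u - 1) := by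
    exact_mod_cast Nat.choose_le_choose _ (hookIn_le_card U r)
  have hW := weight_nonneg U
  calc _ = P.weight U * (s ^ D * ((P.hookIn U u).choose D * a ^ (P.ancIn U u - 1) *
        b ^ P.hookIn U u) * (P.hookIn U r).choose (P.ancIn U u - 1)) := by
        linear_combination (P.weight U * (P.hookIn U r).choose (P.ancIn U u - 1) *
          a ^ (P.ancIn U u - 1)) * h1
    _ ≤ _ := by gcongr

end FinForest

end

theorem theorem5p6 (n₀ j : ℕ) (hj : j + 2 ≤ n₀) (q₁ q₂ q₃ : ℝ)
    (hq₁ : 0 ≤ q₁) (hq₂ : 0 ≤ q₂) (hq₃ : 0 ≤ q₃) (hsum : q₁ + q₂ + q₃ = 1)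
    (hpos : 0 < q₁ + q₃) (X₀ : RootedForest.OfDegree n₀) (t : ℕ) :
    expectedValue (trintoberMatrix n₀ q₁ q₂ q₃) X₀ t (fun y => fTilde n₀ j q₁ q₃ y.1) ≤
      q₂ ^ ((n₀ - j) * t) * fTilde n₀ j q₁ q₃ X₀.1 * (maxChoose n₀ j X₀.1 : ℝ) := by
  have ha : 0 ≤ q₃ / (q₁ + q₃) := by positivity
  have hb : 0 ≤ q₁ / (q₁ + q₃) := by positivity
  have hab : q₃ / (q₁ + q₃) + q₁ / (q₁ + q₃) = 1 := by field_simp; ring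
  obtain ⟨⟨P⟩, hP⟩ := X₀
  have hP' : P.degree = n₀ := hP
  unfold expectedValue
  rw [RootedForest.trintoberMatrix_pow n₀ hsum (div_mul_cancel₀ q₁ hpos.ne')
    (div_mul_cancel₀ q₃ hpos.ne') hab]
  refine (FinForest.sum_trintoberMatrix_mul_fTilde hj hP' _ _ _ q₁ q₃).trans_le ?_
  have hW := FinForest.weight_pos (P := P) Finset.univ
  rw [div_le_iff₀ hW]
  change _ ≤ q₂ ^ ((n₀ - j) * t) * fTilde n₀ j q₁ q₃ (RootedForest.mk P) *
    (maxChoose n₀ j (RootedForest.mk P) : ℝ) * _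
  rw [RootedForest.fTilde_mk, Finset.mul_sum, Finset.sum_mul, Finset.sum_mul]
  refine Finset.sum_le_sum fun u _ => ?_
  refine (FinForest.conv_conv_vertexFn_le_choose (by omega) ha hb hab (pow_nonneg hq₂ t)
    (pow_le_one₀ hq₂ (by linarith)) (Finset.mem_univ u)).trans ?_
  have hcard : (Finset.univ : Finset P.V).card = n₀ := hP'
  rw [hcard, ← pow_mul, mul_comm t, mul_comm]
  refine mul_le_mul_of_nonneg_right ?_ hW.le
  change _ ≤ q₂ ^ ((n₀ - j) * t) * (((P.hook u).choose (n₀ - j) : ℝ) *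
    (q₃ / (q₁ + q₃)) ^ (P.anc u - 1) * (q₁ / (q₁ + q₃)) ^ P.hook u) * _
  have hh : P.hookIn Finset.univ u = P.hook u := rfl
  have han : P.ancIn Finset.univ u = P.anc u := rfl
  rw [hh, han]
  -- Vertices with small hooks contribute zero, so the maximum need only range over the others.
  rcases lt_or_ge (P.hook u) (n₀ - j) with h | h
  · rw [Nat.choose_eq_zero_of_lt h]
    simp
  · refine mul_le_mul_of_nonneg_left ?_ (by positivity)
    have h1 : n₀.choose (P.anc u - 1) ≤ maxChoose n₀ j (RootedForest.mk P) :=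
      Finset.le_sup (f := fun u => n₀.choose (P.anc u - 1))
        (Finset.mem_filter.2 ⟨Finset.mem_univ u, h⟩)
    exact_mod_cast h1
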